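/- Let $l,d\in\mathbb{N}$ and let $X=(X_t)_{t\in\mathbb{R}^l}$ be an $\mathbb{R}^d$-valued random field on a probability space $(\Omega,\mathcal{F},\mathbb{P})$. Assume that $X$ is strictly stationary (for all $m$, all $s_1,\dots,s_m,h\in\mathbb{R}^l$, the vectors $(X_{s_1+h},\dots,X_{s_m+h})$ and $(X_{s_1},\dots,X_{s_m})$ have the same law) and infinitely divisible (every finite-dimensional distribution of $X$ is, for each $n\ge 1$, the $n$-fold convolution of some probability measure with itself). Let $Q_0$ be the Lévy measure of the law of $X_0$, i.e. the Lévy measure in its Lévy–Khintchine triplet, and assume $$Q_0\bigl(\{x=(x_1,\dots,x_d)\in\mathbb{R}^d:\ \exists j\in\{1,\dots,d\},\ x_j\in 2\pi\mathbb{Z}\}\bigr)=0 .$$ Let $\mathcal{T}$ be the set of all sequences $(t_n)_{n\in\mathbb{N}}$ in $\mathbb{R}^l$ with $\lim_{n\to\infty}\|t_n\|_\infty=\infty$. The field $X$ is called mixing if for all $m\in\mathbb{N}$, $s_1,\dots,s_m,p_1,\dots,p_m\in\mathbb{R}^l$, $\theta_1=(\theta_{1,i})_{i\le m},\theta_2=(\theta_{2,i})_{i\le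 m}\in(\mathbb{R}^d)^m$ and all $(t_n)\in\mathcal{T}$, $$\lim_{n\to\infty}\mathbb{E}\Bigl[e^{\,i\sum_{r=1}^m\langle\theta_{1,r},X_{s_r}\rangle+i\sum_{r=1}^m\langle\theta_{2,r},X_{p_r+t_n}\rangle}\Bigr]=\mathbb{E}\Bigl[e^{\,i\sum_{r=1}^m\langle\theta_{1,r},X_{s_r}\rangle}\Bigr]\,\mathbb{E}\Bigl[e^{\,i\sum_{r=1}^m\langle\theta_{2,r},X_{p_r}\rangle}\Bigr].$$ Then $X$ is mixing if and only if $$\lim_{n\to\infty}\mathbb{E}\Bigl[e^{i(X_{t_n}^{(j)}-X_0^{(k)})}\Bigr]=\mathbb{E}\Bigl[e^{iX_0^{(j)}}\Bigr]\cdot\mathbb{E}\Bigl[e^{-iX_0^{(k)}}\Bigr]$$ for all $j,k\in\{1,\dots,d\}$ and every sequence $(t_n)_{n\in\mathbb{N}}\in\mathcal{T}$. -/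

import Mathlib

open MeasureTheory Filter Topology

noncomputable section

namespace RandomField

/-- Infinite divisibility of a measure `μ` on an additive monoid: for every `n ≥ 1`, `μ` is the
law of the sum of `n` independent random elements with a common probability law `ν`. -/
def IsInfinitelyDivisible {E : Type*} [AddCommMonoid E] [MeasurableSpace E]
    (μ : Measure E) : Prop :=
  ∀ n : ℕ, 1 ≤ n → ∃ ν : Measure E, IsProbabilityMeasure ν ∧
    μ = (Measure.pi (fun _ : Fin n => ν)).map (fun x => ∑ i, x i)

/-- `Q` is a Lévy measure on `ℝ^d`: it does not charge the origin and integrates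
`min(1, ‖x‖²)`. -/
def IsLevyMeasure {d : ℕ} (Q : Measure (EuclideanSpace ℝ (Fin d))) : Prop :=
  Q {0} = 0 ∧ ∫⁻ x, ENNReal.ofReal (min 1 (‖x‖ ^ 2)) ∂Q < ⊤

/-- `(α, S, Q)` is the characteristic (Lévy–Khintchine) triplet of the law `μ` on `ℝ^d`, with
truncation function the indicator of the closed Euclidean unit ball. -/
def HasCharacteristicTriplet {d : ℕ} (μ : Measure (EuclideanSpace ℝ (Fin d)))
    (α : EuclideanSpace ℝ (Fin d)) (S : Matrix (Fin d) (Fin d) ℝ)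
    (Q : Measure (EuclideanSpace ℝ (Fin d))) : Prop :=
  S.PosSemidef ∧ IsLevyMeasure Q ∧
    ∀ θ : EuclideanSpace ℝ (Fin d),
      ∫ x, Complex.exp (Complex.I * (inner ℝ θ x : ℝ)) ∂μ =
        Complex.exp (Complex.I * (inner ℝ θ α : ℝ)
          - (1 / 2 : ℂ) * ((∑ j, ∑ k, θ j * S j k * θ k : ℝ) : ℂ)
          + ∫ x, (Complex.exp (Complex.I * (inner ℝ θ x : ℝ)) - 1
              - (Metric.closedBall (0 : EuclideanSpace ℝ (Fin d)) 1).indicator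
                  (fun y => Complex.I * ((inner ℝ θ y : ℝ) : ℂ)) x) ∂Q)

/-- `Q` is the Lévy measure of the law `μ` on `ℝ^d`. -/
def IsLevyMeasureOf {d : ℕ} (Q μ : Measure (EuclideanSpace ℝ (Fin d))) : Prop :=
  ∃ (α : EuclideanSpace ℝ (Fin d)) (S : Matrix (Fin d) (Fin d) ℝ),
    HasCharacteristicTriplet μ α S Q

variable {Ω : Type*} [MeasurableSpace Ω] {l d : ℕ}

/-- The joint law of `(X_{s_1}, …, X_{s_m})`. The index set `ℝ^l` is `Fin l → ℝ`, whose norm is the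
supremum norm. -/
def jointLaw (P : Measure Ω) (X : (Fin l → ℝ) → Ω → EuclideanSpace ℝ (Fin d)) {m : ℕ}
    (s : Fin m → (Fin l → ℝ)) : Measure (Fin m → EuclideanSpace ℝ (Fin d)) :=
  P.map (fun ω i => X (s i) ω)

/-- Strict stationarity: the finite-dimensional distributions are invariant under translations. -/
def IsStrictlyStationary (P : Measure Ω)
    (X : (Fin l → ℝ) → Ω → EuclideanSpace ℝ (Fin d)) : Prop :=
  ∀ (m : ℕ) (s : Fin m → (Fin l → ℝ)) (h : Fin l → ℝ),
    jointLaw P X (fun i => s i + h) = jointLaw P X s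

/-- A random field is infinitely divisible if all its finite-dimensional distributions are. -/
def IsInfinitelyDivisibleField (P : Measure Ω)
    (X : (Fin l → ℝ) → Ω → EuclideanSpace ℝ (Fin d)) : Prop :=
  ∀ (m : ℕ) (s : Fin m → (Fin l → ℝ)), IsInfinitelyDivisible (jointLaw P X s)

/-- The class of sequences `(t_n)` in `ℝ^l` with `‖t_n‖_∞ → ∞`. -/
def EscapingSeq (l : ℕ) : Set (ℕ → (Fin l → ℝ)) :=
  {t | Tendsto (fun n => ‖t n‖) atTop atTop}

/-- Mixing, in terms of characteristic functions. Here `θ₁, θ₂ ∈ ℝ^{md}` are given by their `m`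
blocks in `ℝ^d`, so that `⟨θ₁, X_λ⟩ = ∑ i, ⟨θ₁ i, X_{s i}⟩`. -/
def IsMixing (P : Measure Ω) (X : (Fin l → ℝ) → Ω → EuclideanSpace ℝ (Fin d)) : Prop :=
  ∀ (m : ℕ) (s p : Fin m → (Fin l → ℝ)) (θ₁ θ₂ : Fin m → EuclideanSpace ℝ (Fin d)),
    ∀ t ∈ EscapingSeq l,
      Tendsto
        (fun n : ℕ => ∫ ω, Complex.exp
          (Complex.I * ((∑ i, inner ℝ (θ₁ i) (X (s i) ω) : ℝ) : ℂ)
            + Complex.I * ((∑ i, inner ℝ (θ₂ i) (X (p i + t n) ω) : ℝ) : ℂ)) ∂P)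
        atTop
        (𝓝 ((∫ ω, Complex.exp (Complex.I * ((∑ i, inner ℝ (θ₁ i) (X (s i) ω) : ℝ) : ℂ)) ∂P)
          * ∫ ω, Complex.exp (Complex.I * ((∑ i, inner ℝ (θ₂ i) (X (p i) ω) : ℝ) : ℂ)) ∂P))

end RandomField

end

/-!
The condition on the diagonal `j = k` already suffices for mixing; the converse is the choice of
unit vectors for `θ₁` and `θ₂`.

Write `Y` and `Z` for the values of the field at a site `s` and at an escaping site `p + t n`.
The condition says that the centred variables `exp (i X_t^j)` become orthogonal in `L²` as `t`
escapes. A bounded sequence drawn from a family and asymptotically orthogonal to each of its members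
tends weakly to zero (`tendsto_inner_of_forall_family`), so `𝔼 [g * exp (± i Z_j)]` factorizes
asymptotically for *every* bounded `g` (`IsStrictlyStationary.tendsto_integral_mul_expI`). Taking
`g = exp (i τ Y_a)` gives factorization of the characteristic function along rays in the first
variable.

No Lévy–Khintchine formula is needed for the joint laws. Let `ν k` be a `(k + 1)`-st convolution
root of the joint law, whose single-site marginals have the characteristic function
`exp (ψ / (k + 1))`, with `ψ` the exponent of `X_0`. The root of the characteristic function
is determined by continuity along a ray, which turns the factorization above into
`(k + 1) ∫ (exp (i Y_a) - 1) (exp (± i Z_b) - 1) ∂ν k → 0`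
(`tendsto_succ_mul_integral_expI_sub_one_mul`). Adding the two signs and taking real parts yields
`(k + 1) ∫ (1 - cos Y_a) (1 - cos Z_b) ∂ν k → 0`: the Lévy measure of a limit pair would be
carried by points where one of the two blocks lies on the lattice `(2πℤ)^d`.

The single-site roots, multiplied by `k + 1` and by `weight`, a function comparable to
`min 1 ‖z‖²`, converge weakly to the weighted Lévy measure `Q₀` plus an atom at the origin
(`tendsto_charFun_weighted_root`, from the Lévy continuity theorem). As `Q₀` does not charge
the lattice, the mass near its nonzero points is negligible
(`exists_eventually_root_nearLattice_le`), whence `(k + 1) ∫ weight Y * weight Z ∂ν k → 0`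
(`tendsto_succ_mul_integral_weight_mul_weight`).

Characters of several blocks agree, up to an error bounded by the weights, with linear combinations
of the coordinate characters (`exists_linIncr_bounds`), so their covariances under `ν k` are
`o(1 / k)` (`tendsto_succ_mul_integral_charIncr_mul`). Since `‖aⁿ - bⁿ‖ ≤ n ‖a - b‖` on the unit
disc, the characteristic functions of the joint laws themselves factorize asymptotically
(`isMixing_of_tendsto_integral_expI_sub`). This last step also disposes of the Gaussian part: its
covariance enters only through the coordinate characters.
-/

open MeasureTheory Filter Topology

noncomputable section

namespace RandomField

/-! ### Elementary estimates for complex exponentials -/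

/-- The character `a ↦ exp (i a)` of the real line. -/
def expI (a : ℝ) : ℂ := Complex.exp (Complex.I * a)

@[simp] lemma expI_zero : expI 0 = 1 := by simp [expI]

lemma expI_add (a b : ℝ) : expI (a + b) = expI a * expI b := by
  simp only [expI, Complex.ofReal_add, mul_add, Complex.exp_add]

lemma expI_sum {ι : Type*} (s : Finset ι) (f : ι → ℝ) :
    expI (∑ i ∈ s, f i) = ∏ i ∈ s, expI (f i) := by
  simp only [expI, Complex.ofReal_sum, Finset.mul_sum, Complex.exp_sum]

@[simp] lemma norm_expI (a : ℝ) : ‖expI a‖ = 1 := by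
  rw [expI, mul_comm]; exact Complex.norm_exp_ofReal_mul_I a

lemma norm_expI_sub_one_le (a : ℝ) : ‖expI a - 1‖ ≤ |a| :=
  Real.norm_exp_I_mul_ofReal_sub_one_le

lemma norm_expI_sub_one_le_two (a : ℝ) : ‖expI a - 1‖ ≤ 2 := by
  refine (norm_sub_le _ _).trans ?_
  simp; norm_num

lemma expI_eq (a : ℝ) : expI a = Real.cos a + Real.sin a * Complex.I := by
  rw [expI, mul_comm, Complex.exp_mul_I, Complex.ofReal_cos, Complex.ofReal_sin]

lemma expI_re (a : ℝ) : (expI a).re = Real.cos a := by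
  rw [expI_eq]; simp [-Complex.ofReal_cos, -Complex.ofReal_sin]

lemma expI_neg (a : ℝ) : expI (-a) = starRingEnd ℂ (expI a) := by
  rw [expI_eq, expI_eq]; simp [-Complex.ofReal_cos, -Complex.ofReal_sin, Complex.conj_ofReal]

@[fun_prop] lemma continuous_expI : Continuous expI := by unfold expI; fun_prop

@[fun_prop] lemma measurable_expI : Measurable expI := continuous_expI.measurable

lemma norm_expI_sub_one_sub_le (a : ℝ) : ‖expI a - 1 - Complex.I * a‖ ≤ 3 * a ^ 2 := by
  rcases le_total |a| 1 with h | h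
  · have := Complex.norm_exp_sub_one_sub_id_le (x := Complex.I * a) (by simpa using h)
    simp only [norm_mul, Complex.norm_I, one_mul, Complex.norm_real, Real.norm_eq_abs,
      sq_abs] at this
    exact this.trans (by nlinarith [sq_nonneg a])
  · have h1 : ‖expI a - 1 - Complex.I * a‖ ≤ ‖expI a - 1‖ + ‖Complex.I * a‖ := norm_sub_le _ _
    have h2 : ‖Complex.I * (a : ℂ)‖ = |a| := by simp
    have h3 := norm_expI_sub_one_le a
    nlinarith [sq_abs a]

/-- Up to an error of second order, `exp (i ∑ ηᵢ xᵢ) - 1` is the linear combination of the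
`exp (i xᵢ) - 1` with coefficients `ηᵢ`; the error is bounded as well, since both terms are. -/
lemma norm_expI_sum_sub_one_sub_le {ι : Type*} [Fintype ι] (η : ι → ℝ) :
    ∃ C : ℝ, 0 ≤ C ∧ ∀ x : ι → ℝ,
      ‖expI (∑ i, η i * x i) - 1 - ∑ i, (η i : ℂ) * (expI (x i) - 1)‖
        ≤ C * min 1 (∑ i, x i ^ 2) := by
  set A := ∑ i, η i ^ 2 with hA
  set B := ∑ i, |η i| with hB
  have hA0 : 0 ≤ A := Finset.sum_nonneg fun i _ => sq_nonneg _
  have hB0 : 0 ≤ B := Finset.sum_nonneg fun i _ => abs_nonneg _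
  refine ⟨3 * A + 3 * B + 2, by positivity, fun x => ?_⟩
  set q := ∑ i, x i ^ 2 with hq
  have hq0 : 0 ≤ q := Finset.sum_nonneg fun i _ => sq_nonneg _
  rcases le_total 1 q with h | h
  · rw [min_eq_left h]
    have h1 : ‖∑ i, (η i : ℂ) * (expI (x i) - 1)‖ ≤ ∑ i, |η i| * 2 := by
      refine (norm_sum_le _ _).trans (Finset.sum_le_sum fun i _ => ?_)
      rw [norm_mul, Complex.norm_real, Real.norm_eq_abs]
      exact mul_le_mul_of_nonneg_left (norm_expI_sub_one_le_two _) (abs_nonneg _)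
    rw [← Finset.sum_mul] at h1
    have h2 := norm_sub_le (expI (∑ i, η i * x i) - 1) (∑ i, (η i : ℂ) * (expI (x i) - 1))
    have h3 := norm_expI_sub_one_le_two (∑ i, η i * x i)
    linarith
  · rw [min_eq_right h]
    have key : expI (∑ i, η i * x i) - 1 - ∑ i, (η i : ℂ) * (expI (x i) - 1)
        = (expI (∑ i, η i * x i) - 1 - Complex.I * ((∑ i, η i * x i : ℝ) : ℂ))
          - ∑ i, (η i : ℂ) * (expI (x i) - 1 - Complex.I * (x i : ℂ)) := by
      simp only [mul_sub, Finset.sum_sub_distrib, Complex.ofReal_sum, Complex.ofReal_mul,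
        Finset.mul_sum]
      have : ∀ i, (η i : ℂ) * (Complex.I * (x i : ℂ)) = Complex.I * ((η i : ℂ) * (x i : ℂ)) :=
        fun i => by ring
      simp only [this]
      ring
    rw [key]
    have h1 : ‖∑ i, (η i : ℂ) * (expI (x i) - 1 - Complex.I * (x i : ℂ))‖
        ≤ ∑ i, |η i| * (3 * q) := by
      refine (norm_sum_le _ _).trans (Finset.sum_le_sum fun i hi => ?_)
      rw [norm_mul, Complex.norm_real, Real.norm_eq_abs]
      refine mul_le_mul_of_nonneg_left ((norm_expI_sub_one_sub_le _).trans ?_) (abs_nonneg _)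
      have : x i ^ 2 ≤ q := Finset.single_le_sum (f := fun i => x i ^ 2)
        (fun i _ => sq_nonneg _) hi
      linarith
    rw [← Finset.sum_mul] at h1
    have h2 := norm_expI_sub_one_sub_le (∑ i, η i * x i)
    have h3 : (∑ i, η i * x i) ^ 2 ≤ A * q := Finset.sum_mul_sq_le_sq_mul_sq _ _ _
    refine (norm_sub_le _ _).trans ?_
    nlinarith

lemma norm_exp_sub_one_le_of_re_nonpos {z : ℂ} (hz : z.re ≤ 0) :
    ‖Complex.exp z - 1‖ ≤ ‖z‖ := by
  have := (convex_halfSpace_re_le 0).norm_image_sub_le_of_norm_hasDerivWithin_le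
    (f := Complex.exp) (f' := Complex.exp) (C := 1) (x := 0) (y := z)
    (fun x _ => (Complex.hasDerivAt_exp x).hasDerivWithinAt)
    (fun x hx => by
      rw [Complex.norm_exp]; exact Real.exp_le_one_iff.2 hx) (by simp) hz
  simpa using this

lemma norm_natCast_add_one (k : ℕ) : ‖((k : ℂ) + 1)‖ = (k : ℝ) + 1 := by
  have : (k : ℂ) + 1 = (((k : ℝ) + 1 : ℝ) : ℂ) := by push_cast; ring
  rw [this, Complex.norm_real, Real.norm_of_nonneg (by positivity)]

lemma tendsto_succ_mul_exp_div_sub_one {z : ℕ → ℂ} {a : ℂ} (h : Tendsto z atTop (𝓝 a)) :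
    Tendsto (fun k : ℕ => ((k : ℂ) + 1) * (Complex.exp (z k / ((k : ℂ) + 1)) - 1))
      atTop (𝓝 a) := by
  have h0 : Tendsto (fun k : ℕ => ‖z k‖ * (1 / ((k : ℝ) + 1))) atTop (𝓝 0) := by
    simpa using h.norm.mul tendsto_one_div_add_atTop_nhds_zero_nat
  have h1 : Tendsto (fun k : ℕ => ‖z k‖ * (‖z k‖ * (1 / ((k : ℝ) + 1)))) atTop (𝓝 0) := by
    simpa using h.norm.mul h0
  have h2 : Tendsto (fun k : ℕ => ((k : ℂ) + 1) * (Complex.exp (z k / ((k : ℂ) + 1)) - 1) - z k)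
      atTop (𝓝 0) := by
    refine squeeze_zero_norm' ?_ h1
    filter_upwards [h0.eventually (ge_mem_nhds zero_lt_one)] with k hk
    have hn := norm_natCast_add_one k
    have hne : (k : ℂ) + 1 ≠ 0 := by exact_mod_cast k.succ_ne_zero
    have hz : ‖z k / ((k : ℂ) + 1)‖ = ‖z k‖ * (1 / ((k : ℝ) + 1)) := by
      rw [norm_div, hn, div_eq_mul_one_div]
    have := Complex.norm_exp_sub_one_sub_id_le (x := z k / ((k : ℂ) + 1)) (by rw [hz]; exact hk)
    have e : ((k : ℂ) + 1) * (Complex.exp (z k / ((k : ℂ) + 1)) - 1) - z k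
        = ((k : ℂ) + 1) * (Complex.exp (z k / ((k : ℂ) + 1)) - 1 - z k / ((k : ℂ) + 1)) := by
      field_simp
    rw [e, norm_mul, hn]
    calc ((k : ℝ) + 1) * ‖Complex.exp (z k / ((k : ℂ) + 1)) - 1 - z k / ((k : ℂ) + 1)‖
        ≤ ((k : ℝ) + 1) * ‖z k / ((k : ℂ) + 1)‖ ^ 2 := by gcongr
      _ = ‖z k‖ * (‖z k‖ * (1 / ((k : ℝ) + 1))) := by
        rw [hz]; field_simp
  simpa using h2.add h

lemma norm_pow_sub_pow_le {a b : ℂ} (ha : ‖a‖ ≤ 1) (hb : ‖b‖ ≤ 1) (n : ℕ) :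
    ‖a ^ n - b ^ n‖ ≤ n * ‖a - b‖ := by
  induction n with
  | zero => simp
  | succ n ih =>
    have e : a ^ (n + 1) - b ^ (n + 1) = a * (a ^ n - b ^ n) + (a - b) * b ^ n := by ring
    rw [e]
    refine (norm_add_le _ _).trans ?_
    rw [norm_mul, norm_mul, norm_pow]
    have h1 : ‖a‖ * ‖a ^ n - b ^ n‖ ≤ 1 * ‖a ^ n - b ^ n‖ := by gcongr
    have h2 : ‖a - b‖ * ‖b‖ ^ n ≤ ‖a - b‖ * 1 := by
      gcongr; exact pow_le_one₀ (norm_nonneg _) hb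
    push_cast
    linarith

/-- A continuous path of `n`-th roots of unity that starts at `1` stays there. -/
lemma eqOn_one_of_pow_eq_one {n : ℕ} (hn : n ≠ 0) {c : ℝ → ℂ}
    (hc : ContinuousOn c (Set.Icc 0 1)) (hpow : ∀ x ∈ Set.Icc (0 : ℝ) 1, c x ^ n = 1)
    (h0 : c 0 = 1) : ∀ x ∈ Set.Icc (0 : ℝ) 1, c x = 1 := by
  have hfin : {z : ℂ | z ^ n = 1}.Finite := by
    refine ((Polynomial.nthRootsFinset n (1 : ℂ)).finite_toSet).subset fun z hz => ?_
    exact (Polynomial.mem_nthRootsFinset (Nat.pos_of_ne_zero hn) (1 : ℂ)).2 hz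
  intro x hx
  rw [isPreconnected_Icc.constant_of_mapsTo hfin.isDiscrete hc hpow hx
    (⟨le_rfl, zero_le_one⟩ : (0 : ℝ) ∈ Set.Icc (0 : ℝ) 1), h0]

/-- If `r ^ n = exp ∘ L` along a path on which `r` and `L` are continuous, and `r 0 = 1`,
`L 0 = 0`, then `r` is the distinguished `n`-th root `exp (L / n)`. -/
lemma eqOn_exp_div_of_pow_eq_exp {n : ℕ} (hn : n ≠ 0) {r L : ℝ → ℂ}
    (hr : ContinuousOn r (Set.Icc 0 1)) (hL : ContinuousOn L (Set.Icc 0 1))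
    (h : ∀ x ∈ Set.Icc (0 : ℝ) 1, r x ^ n = Complex.exp (L x)) (hr0 : r 0 = 1) (hL0 : L 0 = 0) :
    ∀ x ∈ Set.Icc (0 : ℝ) 1, r x = Complex.exp (L x / n) := by
  intro x hx
  have hn' : (n : ℂ) ≠ 0 := by exact_mod_cast hn
  have := eqOn_one_of_pow_eq_one (c := fun x => r x * Complex.exp (-(L x / n))) hn
    (hr.mul ((hL.div_const _).neg.cexp)) (fun y hy => by
      rw [mul_pow, h y hy, ← Complex.exp_nat_mul, ← Complex.exp_add]
      rw [mul_neg, mul_div_cancel₀ _ hn', add_neg_cancel, Complex.exp_zero])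
    (by simp [hr0, hL0]) x hx
  rw [Complex.exp_neg] at this
  rwa [← div_eq_mul_inv, div_eq_one_iff_eq (Complex.exp_ne_zero _)] at this

/-! ### Weak convergence to zero in a Hilbert space -/

/-- If a bounded sequence drawn from a family `f` becomes orthogonal to every member of the family,
then it tends weakly to zero: it does so on the closed span of the family, and it vanishes on the
orthogonal complement. -/
lemma tendsto_inner_of_forall_family {H T : Type*} [NormedAddCommGroup H] [InnerProductSpace ℂ H]
    [CompleteSpace H] (f : T → H) {C : ℝ} (hC : ∀ s, ‖f s‖ ≤ C) (t : ℕ → T)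
    (h : ∀ s, Tendsto (fun n => inner ℂ (f s) (f (t n))) atTop (𝓝 0)) (g : H) :
    Tendsto (fun n => inner ℂ g (f (t n))) atTop (𝓝 0) := by
  set K := (Submodule.span ℂ (Set.range f)).topologicalClosure with hK
  have hfK : ∀ s, f s ∈ K := fun s =>
    Submodule.le_topologicalClosure _ (Submodule.subset_span ⟨s, rfl⟩)
  have hspan : ∀ x ∈ Submodule.span ℂ (Set.range f),
      Tendsto (fun n => inner ℂ x (f (t n))) atTop (𝓝 0) := by
    intro x hx
    induction hx using Submodule.span_induction with
    | mem x hx => obtain ⟨s, rfl⟩ := hx; exact h s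
    | zero => simp
    | add x y _ _ hx hy => simpa [inner_add_left] using hx.add hy
    | smul a x _ hx => simpa [inner_smul_left] using hx.mul_const (starRingEnd ℂ a)
  have hclos : ∀ x ∈ K, Tendsto (fun n => inner ℂ x (f (t n))) atTop (𝓝 0) := by
    intro x hx
    have hC0 : 0 ≤ C := (norm_nonneg _).trans (hC (t 0))
    rw [Metric.tendsto_atTop]
    intro ε hε
    obtain ⟨y, hy, hxy⟩ := Metric.mem_closure_iff.1 hx (ε / (2 * (C + 1))) (by positivity)
    obtain ⟨N, hN⟩ := Metric.tendsto_atTop.1 (hspan y hy) (ε / 2) (by positivity)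
    refine ⟨N, fun n hn => ?_⟩
    have h1 := hN n hn
    rw [dist_zero_right] at h1 ⊢
    have e : inner ℂ x (f (t n)) = inner ℂ (x - y) (f (t n)) + inner ℂ y (f (t n)) := by
      rw [inner_sub_left]; ring
    have h2 : ‖inner ℂ (x - y) (f (t n))‖ ≤ ε / 2 := by
      refine (norm_inner_le_norm _ _).trans ?_
      rw [dist_eq_norm] at hxy
      calc ‖x - y‖ * ‖f (t n)‖ ≤ ε / (2 * (C + 1)) * (C + 1) := by
            gcongr; exact (hC _).trans (by linarith)
        _ = ε / 2 := by field_simp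
    rw [e]
    exact (norm_add_le _ _).trans_lt (by linarith)
  have : CompleteSpace K := (Submodule.isClosed_topologicalClosure _).completeSpace_coe
  have e : ∀ n, inner ℂ g (f (t n))
      = inner ℂ ((K.orthogonalProjectionOnto g : K) : H) (f (t n)) := by
    intro n
    have h1 := K.sub_starProjection_mem_orthogonal g
    have := (Submodule.mem_orthogonal' K _).1 h1 (f (t n)) (hfK _)
    rw [inner_sub_left, sub_eq_zero] at this
    exact this
  simp only [e]
  exact hclos _ (Subtype.mem _)

section

variable {d : ℕ}

/-! ### The weight `1 - exp (-‖z‖² / 2)` -/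

/-- A bounded continuous weight comparable to `min 1 ‖z‖²`. It is the average of
`1 - cos ⟪u, z⟫` over a standard Gaussian vector `u`. -/
def weight (z : EuclideanSpace ℝ (Fin d)) : ℝ := 1 - Real.exp (-‖z‖ ^ 2 / 2)

@[fun_prop] lemma continuous_weight : Continuous (weight (d := d)) := by
  unfold weight; fun_prop

@[fun_prop] lemma measurable_weight : Measurable (weight (d := d)) := continuous_weight.measurable

lemma weight_nonneg (z : EuclideanSpace ℝ (Fin d)) : 0 ≤ weight z := by
  rw [weight, sub_nonneg, Real.exp_le_one_iff]
  have := sq_nonneg ‖z‖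
  linarith

lemma weight_le_one (z : EuclideanSpace ℝ (Fin d)) : weight z ≤ 1 := by
  rw [weight]; linarith [Real.exp_pos (-‖z‖ ^ 2 / 2)]

lemma weight_le_min (z : EuclideanSpace ℝ (Fin d)) : weight z ≤ min 1 (‖z‖ ^ 2) := by
  refine le_min (weight_le_one z) ?_
  rw [weight]
  have := Real.add_one_le_exp (-‖z‖ ^ 2 / 2)
  nlinarith [sq_nonneg ‖z‖]

lemma min_le_weight (z : EuclideanSpace ℝ (Fin d)) : min 1 (‖z‖ ^ 2) ≤ 3 * weight z := by
  rw [weight]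
  set q := ‖z‖ ^ 2 with hq
  have hq0 : 0 ≤ q := sq_nonneg _
  have h1 : (1 + q / 2) * Real.exp (-q / 2) ≤ 1 := by
    calc (1 + q / 2) * Real.exp (-q / 2) ≤ Real.exp (q / 2) * Real.exp (-q / 2) := by
          gcongr; linarith [Real.add_one_le_exp (q / 2)]
      _ = 1 := by rw [← Real.exp_add]; ring_nf; exact Real.exp_zero
  have hE := Real.exp_pos (-q / 2)
  rcases le_total 1 q with h | h
  · rw [min_eq_left h]; nlinarith
  · rw [min_eq_right h]; nlinarith

lemma integrable_expI_comp {S : Type*} [MeasurableSpace S] {ν : Measure S} [IsFiniteMeasure ν]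
    {f : S → ℝ} (hf : Measurable f) : Integrable (fun x => expI (f x)) ν :=
  Integrable.of_bound (measurable_expI.comp hf).aestronglyMeasurable 1
    (Eventually.of_forall fun x => by simp)

lemma integrable_cos_comp {S : Type*} [MeasurableSpace S] {ν : Measure S} [IsFiniteMeasure ν]
    {f : S → ℝ} (hf : Measurable f) : Integrable (fun x => Real.cos (f x)) ν :=
  Integrable.of_bound (Real.measurable_cos.comp hf).aestronglyMeasurable 1
    (Eventually.of_forall fun x => by simpa using Real.abs_cos_le_one _)

lemma integral_stdGaussian_one_sub_cos (z : EuclideanSpace ℝ (Fin d)) :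
    ∫ u, (1 - Real.cos (inner ℝ u z)) ∂ProbabilityTheory.stdGaussian (EuclideanSpace ℝ (Fin d))
      = weight z := by
  have h := congrArg Complex.re (ProbabilityTheory.charFun_stdGaussian z)
  have e1 : ∀ u : EuclideanSpace ℝ (Fin d),
      Complex.exp ((inner ℝ u z : ℝ) * Complex.I) = expI (inner ℝ u z) := fun u => by
    rw [expI, mul_comm]
  have e2 : Complex.exp (-(‖z‖ : ℂ) ^ 2 / 2) = ((Real.exp (-‖z‖ ^ 2 / 2) : ℝ) : ℂ) := by
    push_cast; rfl
  rw [charFun_apply, e2, Complex.ofReal_re] at h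
  simp only [e1] at h
  have hi : Integrable (fun u => expI (inner ℝ u z))
      (ProbabilityTheory.stdGaussian (EuclideanSpace ℝ (Fin d))) :=
    integrable_expI_comp (by fun_prop)
  have h2 := integral_re hi
  simp only [RCLike.re_to_complex, expI_re] at h2
  rw [integral_sub (integrable_const _) (integrable_cos_comp (by fun_prop)), h2, h]
  simp [weight]

/-! ### The Lévy–Khintchine exponent -/

/-- The integrand of the Lévy–Khintchine formula. -/
def levyKernel (θ x : EuclideanSpace ℝ (Fin d)) : ℂ :=
  expI (inner ℝ θ x) - 1 - (Metric.closedBall (0 : EuclideanSpace ℝ (Fin d)) 1).indicator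
    (fun y => Complex.I * ((inner ℝ θ y : ℝ) : ℂ)) x

/-- The quadratic form of a matrix. -/
def quadForm (S : Matrix (Fin d) (Fin d) ℝ) (θ : EuclideanSpace ℝ (Fin d)) : ℝ :=
  ∑ j, ∑ k, θ j * S j k * θ k

/-- The Lévy–Khintchine exponent of the triplet `(α, S, Q)`. -/
def levyExponent (α : EuclideanSpace ℝ (Fin d)) (S : Matrix (Fin d) (Fin d) ℝ)
    (Q : Measure (EuclideanSpace ℝ (Fin d))) (θ : EuclideanSpace ℝ (Fin d)) : ℂ :=
  Complex.I * (inner ℝ θ α : ℝ) - (1 / 2 : ℂ) * (quadForm S θ : ℂ) + ∫ x, levyKernel θ x ∂Q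

lemma norm_levyKernel_le (θ x : EuclideanSpace ℝ (Fin d)) :
    ‖levyKernel θ x‖ ≤ 3 * (1 + ‖θ‖ ^ 2) * min 1 (‖x‖ ^ 2) := by
  by_cases hx : ‖x‖ ≤ 1
  · have hx2 : ‖x‖ ^ 2 ≤ 1 := pow_le_one₀ (norm_nonneg _) hx
    rw [levyKernel, Set.indicator_of_mem (by simpa using hx), min_eq_right hx2]
    refine (norm_expI_sub_one_sub_le _).trans ?_
    have h1 : (inner ℝ θ x : ℝ) ^ 2 ≤ (‖θ‖ * ‖x‖) ^ 2 := by
      rw [← sq_abs]; gcongr; exact abs_real_inner_le_norm θ x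
    nlinarith [sq_nonneg ‖x‖, mul_pow ‖θ‖ ‖x‖ 2]
  · have hx2 : 1 ≤ ‖x‖ ^ 2 := one_le_pow₀ (not_le.1 hx).le
    rw [levyKernel, Set.indicator_of_notMem (by simpa using hx), min_eq_left hx2, sub_zero]
    refine (norm_expI_sub_one_le_two _).trans ?_
    nlinarith [sq_nonneg ‖θ‖]

lemma measurable_levyKernel (θ : EuclideanSpace ℝ (Fin d)) : Measurable (levyKernel θ) := by
  unfold levyKernel
  refine ((measurable_expI.comp (by fun_prop)).sub_const 1).sub ?_
  exact Measurable.indicator (by fun_prop) Metric.isClosed_closedBall.measurableSet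

lemma continuous_levyKernel_left (x : EuclideanSpace ℝ (Fin d)) :
    Continuous fun θ => levyKernel θ x := by
  unfold levyKernel
  by_cases hx : x ∈ Metric.closedBall (0 : EuclideanSpace ℝ (Fin d)) 1
  · simp only [Set.indicator_of_mem hx]; fun_prop
  · simp only [Set.indicator_of_notMem hx]; fun_prop

lemma IsLevyMeasure.integrable_min {Q : Measure (EuclideanSpace ℝ (Fin d))}
    (hQ : IsLevyMeasure Q) : Integrable (fun x => min 1 (‖x‖ ^ 2)) Q := by
  refine ⟨by fun_prop, ?_⟩
  rw [hasFiniteIntegral_iff_ofReal (Eventually.of_forall fun x => by positivity)]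
  exact hQ.2

lemma IsLevyMeasure.integrable_levyKernel {Q : Measure (EuclideanSpace ℝ (Fin d))}
    (hQ : IsLevyMeasure Q) (θ : EuclideanSpace ℝ (Fin d)) : Integrable (levyKernel θ) Q :=
  (hQ.integrable_min.const_mul (3 * (1 + ‖θ‖ ^ 2))).mono'
    (measurable_levyKernel θ).aestronglyMeasurable
    (Eventually.of_forall fun x => norm_levyKernel_le θ x)

lemma continuous_quadForm (S : Matrix (Fin d) (Fin d) ℝ) : Continuous (quadForm S) := by
  unfold quadForm; fun_prop

lemma IsLevyMeasure.continuous_levyExponent {Q : Measure (EuclideanSpace ℝ (Fin d))}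
    (hQ : IsLevyMeasure Q) (α : EuclideanSpace ℝ (Fin d)) (S : Matrix (Fin d) (Fin d) ℝ) :
    Continuous (levyExponent α S Q) := by
  have h1 : Continuous fun θ => ∫ x, levyKernel θ x ∂Q := by
    refine continuous_iff_continuousAt.2 fun θ₀ => ?_
    refine continuousAt_of_dominated
      (bound := fun x => 3 * (1 + (‖θ₀‖ + 1) ^ 2) * min 1 (‖x‖ ^ 2))
      (Eventually.of_forall fun θ => (measurable_levyKernel θ).aestronglyMeasurable) ?_
      (hQ.integrable_min.const_mul _)
      (Eventually.of_forall fun x => (continuous_levyKernel_left x).continuousAt)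
    have : ∀ᶠ θ in 𝓝 θ₀, ‖θ‖ < ‖θ₀‖ + 1 :=
      continuous_norm.continuousAt.eventually_lt_const (by linarith)
    filter_upwards [this] with θ hθ
    refine Eventually.of_forall fun x => (norm_levyKernel_le θ x).trans ?_
    gcongr
  have h2 := continuous_quadForm S
  unfold levyExponent
  fun_prop

@[simp] lemma levyExponent_zero (α : EuclideanSpace ℝ (Fin d)) (S : Matrix (Fin d) (Fin d) ℝ)
    (Q : Measure (EuclideanSpace ℝ (Fin d))) : levyExponent α S Q 0 = 0 := by
  simp [levyExponent, levyKernel, quadForm]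

lemma abs_quadForm_le (S : Matrix (Fin d) (Fin d) ℝ) (θ : EuclideanSpace ℝ (Fin d)) :
    |quadForm S θ| ≤ (∑ j, ∑ k, |S j k|) * ‖θ‖ ^ 2 := by
  simp only [quadForm, Finset.sum_mul]
  refine (Finset.abs_sum_le_sum_abs _ _).trans (Finset.sum_le_sum fun j _ => ?_)
  refine (Finset.abs_sum_le_sum_abs _ _).trans (Finset.sum_le_sum fun k _ => ?_)
  rw [abs_mul, abs_mul]
  have h1 : |θ j| ≤ ‖θ‖ := PiLp.norm_apply_le θ j
  have h2 : |θ k| ≤ ‖θ‖ := PiLp.norm_apply_le θ k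
  calc |θ j| * |S j k| * |θ k| ≤ ‖θ‖ * |S j k| * ‖θ‖ := by gcongr
    _ = |S j k| * ‖θ‖ ^ 2 := by ring

lemma quadForm_nonneg {S : Matrix (Fin d) (Fin d) ℝ} (hS : S.PosSemidef)
    (θ : EuclideanSpace ℝ (Fin d)) : 0 ≤ quadForm S θ := by
  have := hS.dotProduct_mulVec_nonneg (fun j => θ j)
  simpa [quadForm, dotProduct, Matrix.mulVec, Finset.mul_sum, mul_assoc] using this

lemma IsLevyMeasure.exists_norm_levyExponent_le {Q : Measure (EuclideanSpace ℝ (Fin d))}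
    (hQ : IsLevyMeasure Q) (α : EuclideanSpace ℝ (Fin d)) (S : Matrix (Fin d) (Fin d) ℝ) :
    ∃ C : ℝ, ∀ θ, ‖levyExponent α S Q θ‖ ≤ C * (1 + ‖θ‖ ^ 2) := by
  set A := ∑ j, ∑ k, |S j k| with hA
  have hA0 : 0 ≤ A := Finset.sum_nonneg fun j _ => Finset.sum_nonneg fun k _ => abs_nonneg _
  set q := ∫ x, min 1 (‖x‖ ^ 2) ∂Q with hq
  refine ⟨‖α‖ + A + 3 * q, fun θ => ?_⟩
  have h1 : ‖Complex.I * ((inner ℝ θ α : ℝ) : ℂ)‖ ≤ ‖θ‖ * ‖α‖ := by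
    simpa using abs_real_inner_le_norm θ α
  have h2 : ‖(1 / 2 : ℂ) * (quadForm S θ : ℂ)‖ ≤ 1 / 2 * (A * ‖θ‖ ^ 2) := by
    rw [norm_mul, Complex.norm_real, Real.norm_eq_abs]
    norm_num
    exact abs_quadForm_le S θ
  have h3 : ‖∫ x, levyKernel θ x ∂Q‖ ≤ 3 * (1 + ‖θ‖ ^ 2) * q := by
    rw [hq, ← integral_const_mul]
    exact norm_integral_le_of_norm_le (hQ.integrable_min.const_mul _)
      (Eventually.of_forall fun x => norm_levyKernel_le θ x)
  have h4 : ‖levyExponent α S Q θ‖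
      ≤ ‖θ‖ * ‖α‖ + 1 / 2 * (A * ‖θ‖ ^ 2) + 3 * (1 + ‖θ‖ ^ 2) * q :=
    (norm_add_le _ _).trans (add_le_add ((norm_sub_le _ _).trans (add_le_add h1 h2)) h3)
  have h5 : ‖θ‖ * ‖α‖ ≤ ‖α‖ * (1 + ‖θ‖ ^ 2) := by
    nlinarith [norm_nonneg α, sq_nonneg (‖θ‖ - 1)]
  nlinarith [sq_nonneg ‖θ‖]

lemma expI_mul_one_sub_cos (a b : ℝ) :
    expI a * ((1 - Real.cos b : ℝ) : ℂ) = expI a - 1 / 2 * expI (a + b) - 1 / 2 * expI (a - b) := by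
  rw [sub_eq_add_neg a b, expI_add, expI_add, expI_eq b, expI_eq (-b)]
  push_cast [Real.cos_neg, Real.sin_neg]
  ring

/-- Second differences of the exponent do not see the drift, and their Gaussian part is
constant. -/
lemma IsLevyMeasure.levyExponent_second_difference {Q : Measure (EuclideanSpace ℝ (Fin d))}
    (hQ : IsLevyMeasure Q) (α : EuclideanSpace ℝ (Fin d)) (S : Matrix (Fin d) (Fin d) ℝ)
    (θ u : EuclideanSpace ℝ (Fin d)) :
    levyExponent α S Q θ - 1 / 2 * levyExponent α S Q (θ + u) - 1 / 2 * levyExponent α S Q (θ - u)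
      = ((quadForm S u / 2 : ℝ) : ℂ)
        + ∫ x, expI (inner ℝ θ x) * ((1 - Real.cos (inner ℝ u x) : ℝ) : ℂ) ∂Q := by
  have hk : ∀ x, expI (inner ℝ θ x) * ((1 - Real.cos (inner ℝ u x) : ℝ) : ℂ)
      = levyKernel θ x - 1 / 2 * levyKernel (θ + u) x - 1 / 2 * levyKernel (θ - u) x := by
    intro x
    rw [expI_mul_one_sub_cos]
    simp only [levyKernel, inner_add_left, inner_sub_left]
    by_cases hx : x ∈ Metric.closedBall (0 : EuclideanSpace ℝ (Fin d)) 1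
    · simp only [Set.indicator_of_mem hx]; push_cast; ring
    · simp only [Set.indicator_of_notMem hx]; ring
  have i1 := hQ.integrable_levyKernel θ
  have i2 := (hQ.integrable_levyKernel (θ + u)).const_mul (1 / 2 : ℂ)
  have i3 := (hQ.integrable_levyKernel (θ - u)).const_mul (1 / 2 : ℂ)
  have hq : quadForm S θ - 1 / 2 * quadForm S (θ + u) - 1 / 2 * quadForm S (θ - u)
      = - quadForm S u := by
    simp only [quadForm, Finset.mul_sum, ← Finset.sum_sub_distrib, ← Finset.sum_neg_distrib]
    refine Finset.sum_congr rfl fun j _ => Finset.sum_congr rfl fun k _ => ?_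
    simp only [PiLp.add_apply, PiLp.sub_apply]
    ring
  have i12 : Integrable (fun x => levyKernel θ x - 1 / 2 * levyKernel (θ + u) x) Q := i1.sub i2
  simp only [hk]
  rw [integral_sub i12 i3, integral_sub i1 i2, integral_const_mul, integral_const_mul]
  have hq' : quadForm S u = -(quadForm S θ - 1 / 2 * quadForm S (θ + u)
    - 1 / 2 * quadForm S (θ - u)) := by rw [hq, neg_neg]
  rw [hq']
  simp only [levyExponent, inner_add_left, inner_sub_left]
  push_cast
  ring

/-- A convolution root of an infinitely divisible law has the distinguished root of the
characteristic function as characteristic function, by continuity along rays. -/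
lemma integral_expI_eq_exp_div {T : Type*} [MeasurableSpace T] {ν : Measure T}
    [IsProbabilityMeasure ν] {W : T → EuclideanSpace ℝ (Fin d)} (hW : Measurable W)
    {ψ : EuclideanSpace ℝ (Fin d) → ℂ} (hψ : Continuous ψ) (hψ0 : ψ 0 = 0) {k : ℕ}
    (h : ∀ u, (∫ x, expI (inner ℝ u (W x)) ∂ν) ^ (k + 1) = Complex.exp (ψ u))
    (u : EuclideanSpace ℝ (Fin d)) :
    ∫ x, expI (inner ℝ u (W x)) ∂ν = Complex.exp (ψ u / ((k : ℂ) + 1)) := by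
  have hc : Continuous fun τ : ℝ => ∫ x, expI (inner ℝ (τ • u) (W x)) ∂ν := by
    refine continuous_of_dominated (bound := fun _ => 1) (fun τ => ?_) (fun τ => ?_)
      (integrable_const _) ?_
    · exact (measurable_expI.comp (by fun_prop)).aestronglyMeasurable
    · simp
    · exact Eventually.of_forall fun x => by fun_prop
  have := eqOn_exp_div_of_pow_eq_exp (n := k + 1) k.succ_ne_zero hc.continuousOn
    (L := fun τ : ℝ => ψ (τ • u)) (by fun_prop) (fun τ _ => h _) (by simp) (by simpa using hψ0)
    1 (by simp)
  simpa using this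

end

section

/-! ### Lévy continuity for finite measures -/

/-- The Lévy continuity theorem for finite measures: convergence of the characteristic functions
contains convergence of the masses, so that one can normalize. -/
lemma tendsto_finiteMeasure_of_tendsto_charFun {E : Type*} [NormedAddCommGroup E]
    [InnerProductSpace ℝ E] [FiniteDimensional ℝ E] [MeasurableSpace E] [BorelSpace E]
    {M : ℕ → FiniteMeasure E} {M₀ : FiniteMeasure E}
    (h : ∀ t, Tendsto (fun n => charFun (M n : Measure E) t) atTop
      (𝓝 (charFun (M₀ : Measure E) t))) :
    Tendsto M atTop (𝓝 M₀) := by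
  have hmassC : ∀ N : FiniteMeasure E, charFun (N : Measure E) 0 = ((N.mass : ℝ) : ℂ) := by
    intro N
    rw [charFun_zero]
    rfl
  have hmass : Tendsto (fun n => (M n).mass) atTop (𝓝 M₀.mass) := by
    have h0 := h 0
    simp only [hmassC] at h0
    have := (Complex.continuous_re.tendsto _).comp h0
    simpa [Function.comp_def] using this
  by_cases h0 : M₀ = 0
  · subst h0
    exact FiniteMeasure.tendsto_zero_of_tendsto_zero_mass (by simpa using hmass)
  have hne : ∀ᶠ n in atTop, M n ≠ 0 := by
    filter_upwards [hmass.eventually_ne (M₀.mass_nonzero_iff.2 h0)] with n hn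
    exact (M n).mass_nonzero_iff.1 hn
  have hnorm : ∀ N : FiniteMeasure E, N ≠ 0 → ∀ t,
      charFun (N.normalize : Measure E) t = ((N.mass : ℝ) : ℂ)⁻¹ * charFun (N : Measure E) t := by
    intro N hN t
    rw [N.toMeasure_normalize_eq_of_nonzero hN, charFun_apply, charFun_apply,
      integral_smul_nnreal_measure, NNReal.smul_def, Complex.real_smul]
    push_cast
    rfl
  refine FiniteMeasure.tendsto_of_tendsto_normalize_testAgainstNN_of_tendsto_mass
    (ProbabilityMeasure.tendsto_of_tendsto_charFun fun t => ?_) hmass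
  rw [hnorm M₀ h0]
  have hm : Tendsto (fun n => (((M n).mass : ℝ) : ℂ)⁻¹) atTop (𝓝 ((M₀.mass : ℝ) : ℂ)⁻¹) := by
    refine Tendsto.inv₀ ?_ (by simpa using h0)
    exact (Complex.continuous_ofReal.tendsto _).comp ((NNReal.continuous_coe.tendsto _).comp hmass)
  refine (hm.mul (h t)).congr' ?_
  filter_upwards [hne] with n hn
  rw [hnorm _ hn]

variable {d : ℕ}

/-! ### Weak convergence of rescaled convolution roots to the Lévy measure -/

/-- The standard Gaussian law on `ℝ^d`. -/
local notation "γ[" d "]" => ProbabilityTheory.stdGaussian (EuclideanSpace ℝ (Fin d))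

lemma integrable_one_add_sq_norm_stdGaussian :
    Integrable (fun u : EuclideanSpace ℝ (Fin d) => 1 + ‖u‖ ^ 2) γ[d] :=
  (integrable_const _).add
    (ProbabilityTheory.IsGaussian.memLp_two_id (μ := γ[d])).integrable_norm_pow'

lemma one_sub_cos_inner_le (u z : EuclideanSpace ℝ (Fin d)) :
    1 - Real.cos (inner ℝ u z) ≤ 2 * ((1 + ‖u‖ ^ 2) * min 1 (‖z‖ ^ 2)) := by
  have h2 := Real.one_sub_sq_div_two_le_cos (x := (inner ℝ u z : ℝ))
  have h3 : (inner ℝ u z : ℝ) ^ 2 ≤ (‖u‖ * ‖z‖) ^ 2 := by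
    rw [← sq_abs]; gcongr; exact abs_real_inner_le_norm u z
  rw [mul_pow] at h3
  rcases le_total 1 (‖z‖ ^ 2) with h | h
  · rw [min_eq_left h]; nlinarith [Real.neg_one_le_cos (inner ℝ u z : ℝ), sq_nonneg ‖u‖]
  · rw [min_eq_right h]; nlinarith [sq_nonneg ‖u‖, sq_nonneg ‖z‖]

/-- Fubini's theorem for the representation of `weight` as a Gaussian average; it expresses the
characteristic function of a weighted measure through second differences. -/
lemma integral_expI_mul_weight {ν : Measure (EuclideanSpace ℝ (Fin d))} [SFinite ν]
    (hν : Integrable (fun z => min 1 (‖z‖ ^ 2)) ν) (θ : EuclideanSpace ℝ (Fin d)) :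
    ∫ z, expI (inner ℝ θ z) * (weight z : ℂ) ∂ν
      = ∫ u, ∫ z, expI (inner ℝ θ z) * ((1 - Real.cos (inner ℝ u z) : ℝ) : ℂ) ∂ν ∂γ[d] := by
  rw [integral_integral_swap]
  · refine integral_congr_ae (Eventually.of_forall fun z => ?_)
    simp only
    rw [integral_const_mul, integral_complex_ofReal, integral_stdGaussian_one_sub_cos]
  · have hb : Integrable (fun p : EuclideanSpace ℝ (Fin d) × EuclideanSpace ℝ (Fin d) =>
        2 * ((1 + ‖p.1‖ ^ 2) * min 1 (‖p.2‖ ^ 2))) (γ[d].prod ν) :=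
      (integrable_one_add_sq_norm_stdGaussian.mul_prod hν).const_mul 2
    refine hb.mono' (Continuous.aestronglyMeasurable ?_) (Eventually.of_forall fun p => ?_)
    · simp only [Function.uncurry_def]; fun_prop
    · simp only [Function.uncurry_def]
      rw [norm_mul, norm_expI, one_mul, Complex.norm_real, Real.norm_of_nonneg
        (sub_nonneg.2 (Real.cos_le_one _))]
      exact one_sub_cos_inner_le _ _

/-- A Lévy measure has a positive density with respect to a finite measure, since it does not
charge the origin. -/
lemma IsLevyMeasure.sFinite {Q : Measure (EuclideanSpace ℝ (Fin d))} (hQ : IsLevyMeasure Q) :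
    SFinite Q := by
  have hm : Measurable fun x : EuclideanSpace ℝ (Fin d) => ENNReal.ofReal (min 1 (‖x‖ ^ 2)) := by
    fun_prop
  have : IsFiniteMeasure (Q.withDensity fun x => ENNReal.ofReal (min 1 (‖x‖ ^ 2))) :=
    isFiniteMeasure_withDensity hQ.2.ne
  have h0 : ∀ᵐ x ∂Q, ENNReal.ofReal (min 1 (‖x‖ ^ 2)) ≠ 0 := by
    have : ∀ᵐ x ∂Q, x ≠ 0 := by
      rw [ae_iff]; simpa using hQ.1
    filter_upwards [this] with x hx
    rw [Ne, ENNReal.ofReal_eq_zero, not_le]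
    have := norm_pos_iff.2 hx
    positivity
  rw [← withDensity_inv_same hm h0 (Eventually.of_forall fun x => ENNReal.ofReal_ne_top)]
  infer_instance

/-- The measure with density `c * weight` with respect to `ν`. -/
def weighted (ν : Measure (EuclideanSpace ℝ (Fin d))) (c : ℝ) :
    Measure (EuclideanSpace ℝ (Fin d)) :=
  ν.withDensity fun z => ENNReal.ofReal (c * weight z)

lemma integrable_weight {ν : Measure (EuclideanSpace ℝ (Fin d))}
    (hν : Integrable (fun z => min 1 (‖z‖ ^ 2)) ν) : Integrable weight ν :=
  hν.mono' measurable_weight.aestronglyMeasurable (Eventually.of_forall fun z => by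
    rw [Real.norm_of_nonneg (weight_nonneg z)]; exact weight_le_min z)

lemma isFiniteMeasure_weighted {ν : Measure (EuclideanSpace ℝ (Fin d))}
    (hν : Integrable (fun z => min 1 (‖z‖ ^ 2)) ν) (c : ℝ) : IsFiniteMeasure (weighted ν c) :=
  isFiniteMeasure_withDensity_ofReal ((integrable_weight hν).const_mul c).2

lemma charFun_weighted (ν : Measure (EuclideanSpace ℝ (Fin d))) {c : ℝ} (hc : 0 ≤ c)
    (θ : EuclideanSpace ℝ (Fin d)) :
    charFun (weighted ν c) θ = c * ∫ z, expI (inner ℝ θ z) * (weight z : ℂ) ∂ν := by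
  rw [charFun_apply, weighted, integral_withDensity_eq_integral_toReal_smul (by fun_prop)
    (Eventually.of_forall fun x => ENNReal.ofReal_lt_top), ← integral_const_mul]
  refine integral_congr_ae (Eventually.of_forall fun z => ?_)
  simp only
  rw [ENNReal.toReal_ofReal (mul_nonneg hc (weight_nonneg z)), Complex.real_smul, expI,
    real_inner_comm θ z]
  push_cast
  ring_nf

variable {α : EuclideanSpace ℝ (Fin d)} {S : Matrix (Fin d) (Fin d) ℝ}
  {Q : Measure (EuclideanSpace ℝ (Fin d))}
  {ρ : ℕ → Measure (EuclideanSpace ℝ (Fin d))}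

/-- The limit of the weighted, rescaled convolution roots: the weighted Lévy measure, together with
an atom at the origin that collects the Gaussian part. -/
def weightedLimit (S : Matrix (Fin d) (Fin d) ℝ) (Q : Measure (EuclideanSpace ℝ (Fin d))) :
    Measure (EuclideanSpace ℝ (Fin d)) :=
  weighted Q 1 + ENNReal.ofReal (∫ u, quadForm S u / 2 ∂γ[d]) • Measure.dirac 0

lemma isFiniteMeasure_weightedLimit (hQ : IsLevyMeasure Q) :
    IsFiniteMeasure (weightedLimit S Q) := by
  have := isFiniteMeasure_weighted hQ.integrable_min 1
  have : IsFiniteMeasure (ENNReal.ofReal (∫ u, quadForm S u / 2 ∂γ[d]) •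
      Measure.dirac (0 : EuclideanSpace ℝ (Fin d))) :=
    Measure.smul_finite _ ENNReal.ofReal_ne_top
  unfold weightedLimit
  infer_instance

lemma integrable_min_of_isFiniteMeasure (ν : Measure (EuclideanSpace ℝ (Fin d)))
    [IsFiniteMeasure ν] : Integrable (fun z => min 1 (‖z‖ ^ 2)) ν :=
  Integrable.of_bound (Continuous.aestronglyMeasurable (by fun_prop)) 1
    (Eventually.of_forall fun z => by
      rw [Real.norm_of_nonneg (by positivity)]; exact min_le_left _ _)

lemma charFun_weightedLimit (hS : S.PosSemidef) (hQ : IsLevyMeasure Q)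
    (θ : EuclideanSpace ℝ (Fin d)) :
    charFun (weightedLimit S Q) θ = ∫ u, (levyExponent α S Q θ
      - 1 / 2 * levyExponent α S Q (θ + u) - 1 / 2 * levyExponent α S Q (θ - u)) ∂γ[d] := by
  have := hQ.sFinite
  have := isFiniteMeasure_weighted hQ.integrable_min 1
  have : IsFiniteMeasure (ENNReal.ofReal (∫ u, quadForm S u / 2 ∂γ[d]) •
      Measure.dirac (0 : EuclideanSpace ℝ (Fin d))) :=
    Measure.smul_finite _ ENNReal.ofReal_ne_top
  have hq : Integrable (fun u => quadForm S u / 2) γ[d] := by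
    refine (integrable_one_add_sq_norm_stdGaussian.const_mul (∑ j, ∑ k, |S j k|)).mono'
      (((continuous_quadForm S).div_const 2).aestronglyMeasurable)
      (Eventually.of_forall fun u => ?_)
    have hA0 : 0 ≤ ∑ j, ∑ k, |S j k| :=
      Finset.sum_nonneg fun j _ => Finset.sum_nonneg fun k _ => abs_nonneg _
    have := abs_quadForm_le S u
    rw [Real.norm_eq_abs, abs_div, abs_two]
    nlinarith [abs_nonneg (quadForm S u)]
  have hq0 : 0 ≤ ∫ u, quadForm S u / 2 ∂γ[d] :=
    integral_nonneg fun u => div_nonneg (quadForm_nonneg hS u) zero_le_two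
  have hcont : Continuous fun u => levyExponent α S Q θ
      - 1 / 2 * levyExponent α S Q (θ + u) - 1 / 2 * levyExponent α S Q (θ - u) := by
    have := hQ.continuous_levyExponent α S
    fun_prop
  have hint : Integrable (fun u => ∫ z, expI (inner ℝ θ z) *
      ((1 - Real.cos (inner ℝ u z) : ℝ) : ℂ) ∂Q) γ[d] := by
    refine (integrable_one_add_sq_norm_stdGaussian.const_mul
      (2 * ∫ z, min 1 (‖z‖ ^ 2) ∂Q)).mono' ?_ (Eventually.of_forall fun u => ?_)
    · have e : ∀ u, ∫ z, expI (inner ℝ θ z) * ((1 - Real.cos (inner ℝ u z) : ℝ) : ℂ) ∂Q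
          = (levyExponent α S Q θ - 1 / 2 * levyExponent α S Q (θ + u)
            - 1 / 2 * levyExponent α S Q (θ - u)) - ((quadForm S u / 2 : ℝ) : ℂ) := fun u => by
        rw [hQ.levyExponent_second_difference]; ring
      simp only [e]
      have := continuous_quadForm S
      exact (hcont.sub (by fun_prop)).aestronglyMeasurable
    · refine (norm_integral_le_of_norm_le (hQ.integrable_min.const_mul (2 * (1 + ‖u‖ ^ 2)))
        (Eventually.of_forall fun z => ?_)).trans_eq ?_
      · rw [norm_mul, norm_expI, one_mul, Complex.norm_real, Real.norm_of_nonneg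
          (sub_nonneg.2 (Real.cos_le_one _)), mul_assoc]
        exact one_sub_cos_inner_le _ _
      · rw [integral_const_mul]; ring
  simp only [hQ.levyExponent_second_difference]
  have hq' : Integrable (fun u => ((quadForm S u / 2 : ℝ) : ℂ)) γ[d] := hq.ofReal
  rw [integral_add hq' hint, ← integral_expI_mul_weight hQ.integrable_min,
    integral_complex_ofReal]
  have e : charFun (weightedLimit S Q) θ = charFun (weighted Q 1) θ
      + charFun (ENNReal.ofReal (∫ u, quadForm S u / 2 ∂γ[d]) •
        Measure.dirac (0 : EuclideanSpace ℝ (Fin d))) θ := by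
    rw [weightedLimit, charFun_apply, charFun_apply, charFun_apply, integral_add_measure]
    · simpa using integrable_expI_comp (ν := weighted Q 1) (f := fun z => inner ℝ z θ)
        (by fun_prop) |>.congr (Eventually.of_forall fun z => by simp only [expI, mul_comm])
    · simpa using integrable_expI_comp (ν := ENNReal.ofReal (∫ u, quadForm S u / 2 ∂γ[d]) •
        Measure.dirac (0 : EuclideanSpace ℝ (Fin d))) (f := fun z => inner ℝ z θ)
        (by fun_prop) |>.congr (Eventually.of_forall fun z => by simp only [expI, mul_comm])
  rw [e, charFun_weighted Q zero_le_one, charFun_apply, integral_smul_measure,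
    ENNReal.toReal_ofReal hq0, integral_dirac]
  simp [add_comm]

lemma norm_integral_expI_mul_one_sub_cos_le {ν : Measure (EuclideanSpace ℝ (Fin d))}
    [IsProbabilityMeasure ν] (θ u : EuclideanSpace ℝ (Fin d)) :
    ‖∫ z, expI (inner ℝ θ z) * ((1 - Real.cos (inner ℝ u z) : ℝ) : ℂ) ∂ν‖
      ≤ ‖(∫ z, expI (inner ℝ u z) ∂ν) - 1‖ := by
  have hi : Integrable (fun z : EuclideanSpace ℝ (Fin d) => expI (inner ℝ u z)) ν :=
    integrable_expI_comp (by fun_prop)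
  have h1 : ‖∫ z, expI (inner ℝ θ z) * ((1 - Real.cos (inner ℝ u z) : ℝ) : ℂ) ∂ν‖
      ≤ ∫ z, (1 - Real.cos (inner ℝ u z)) ∂ν := by
    refine norm_integral_le_of_norm_le ((integrable_const _).sub
      (integrable_cos_comp (by fun_prop))) (Eventually.of_forall fun z => ?_)
    rw [norm_mul, norm_expI, one_mul, Complex.norm_real, Real.norm_of_nonneg
          (sub_nonneg.2 (Real.cos_le_one _))]
  have h2 := integral_re hi
  simp only [RCLike.re_to_complex, expI_re] at h2
  rw [integral_sub (integrable_const _) (integrable_cos_comp (by fun_prop)), h2] at h1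
  refine h1.trans ?_
  rw [norm_sub_rev]
  refine le_trans (le_of_eq ?_) (Complex.re_le_norm _)
  simp

/-- The measures `(k + 1) * weight * ρ k` converge weakly, where `ρ k` is the `(k + 1)`-st
convolution root of the law with the given triplet. -/
lemma tendsto_charFun_weighted_root (hS : S.PosSemidef) (hQ : IsLevyMeasure Q)
    [∀ k, IsProbabilityMeasure (ρ k)]
    (hρ : ∀ (k : ℕ) θ, ∫ z, expI (inner ℝ θ z) ∂ρ k
      = Complex.exp (levyExponent α S Q θ / ((k : ℂ) + 1))) (θ : EuclideanSpace ℝ (Fin d)) :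
    Tendsto (fun k : ℕ => charFun (weighted (ρ k) ((k : ℝ) + 1)) θ) atTop
      (𝓝 (charFun (weightedLimit S Q) θ)) := by
  have hψc := hQ.continuous_levyExponent α S
  obtain ⟨C, hC⟩ := hQ.exists_norm_levyExponent_le α S
  -- needed for the domination `(k + 1) |exp (ψ u / (k + 1)) - 1| ≤ |ψ u|`
  have hre : ∀ u, (levyExponent α S Q u).re ≤ 0 := by
    intro u
    have h0 := hρ 0 u
    simp only [Nat.cast_zero, zero_add, div_one] at h0
    have h1 : ‖∫ z, expI (inner ℝ u z) ∂ρ 0‖ ≤ 1 := by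
      refine (norm_integral_le_of_norm_le_const (C := 1)
        (Eventually.of_forall fun z => by simp)).trans (by simp)
    rw [h0, Complex.norm_exp] at h1
    exact Real.exp_le_one_iff.1 h1
  have hinner : ∀ (k : ℕ) u, ∫ z, expI (inner ℝ θ z) * ((1 - Real.cos (inner ℝ u z) : ℝ) : ℂ) ∂ρ k
      = Complex.exp (levyExponent α S Q θ / ((k : ℂ) + 1))
        - 1 / 2 * Complex.exp (levyExponent α S Q (θ + u) / ((k : ℂ) + 1))
        - 1 / 2 * Complex.exp (levyExponent α S Q (θ - u) / ((k : ℂ) + 1)) := by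
    intro k u
    have hi : ∀ v, Integrable (fun z : EuclideanSpace ℝ (Fin d) => expI (inner ℝ v z)) (ρ k) :=
      fun v => integrable_expI_comp (by fun_prop)
    have i12 : Integrable (fun z => expI (inner ℝ θ z) - 1 / 2 * expI (inner ℝ (θ + u) z)) (ρ k) :=
      (hi θ).sub ((hi (θ + u)).const_mul _)
    simp only [expI_mul_one_sub_cos, ← inner_add_left, ← inner_sub_left]
    rw [integral_sub i12 ((hi _).const_mul _), integral_sub (hi _) ((hi _).const_mul _),
      integral_const_mul, integral_const_mul, hρ, hρ, hρ]
  have e : ∀ k : ℕ, charFun (weighted (ρ k) ((k : ℝ) + 1)) θ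
      = ∫ u, ((k : ℂ) + 1) * ∫ z, expI (inner ℝ θ z) *
        ((1 - Real.cos (inner ℝ u z) : ℝ) : ℂ) ∂ρ k ∂γ[d] := by
    intro k
    rw [charFun_weighted _ (by positivity),
      integral_expI_mul_weight (integrable_min_of_isFiniteMeasure _), ← integral_const_mul]
    push_cast
    rfl
  simp only [e]
  rw [charFun_weightedLimit (α := α) hS hQ]
  refine tendsto_integral_of_dominated_convergence (fun u => C * (1 + ‖u‖ ^ 2)) (fun k => ?_)
    (integrable_one_add_sq_norm_stdGaussian.const_mul C) (fun k => ?_)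
    (Eventually.of_forall fun u => ?_)
  · simp only [hinner]
    exact Continuous.aestronglyMeasurable (by fun_prop)
  · refine Eventually.of_forall fun u => ?_
    refine le_trans ?_ (hC u)
    rw [norm_mul, norm_natCast_add_one]
    have h1 := norm_integral_expI_mul_one_sub_cos_le (ν := ρ k) θ u
    rw [hρ] at h1
    have h2 : ‖Complex.exp (levyExponent α S Q u / ((k : ℂ) + 1)) - 1‖
        ≤ ‖levyExponent α S Q u‖ / ((k : ℝ) + 1) := by
      rw [← norm_natCast_add_one, ← norm_div]
      refine norm_exp_sub_one_le_of_re_nonpos ?_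
      have : (k : ℂ) + 1 = (((k : ℝ) + 1 : ℝ) : ℂ) := by push_cast; ring
      rw [this, Complex.div_ofReal_re]
      exact div_nonpos_of_nonpos_of_nonneg (hre u) (by positivity)
    calc ((k : ℝ) + 1) * _ ≤ ((k : ℝ) + 1) * (‖levyExponent α S Q u‖ / ((k : ℝ) + 1)) := by
          gcongr; exact h1.trans h2
      _ = ‖levyExponent α S Q u‖ := by field_simp
  · simp only [hinner]
    have hl : ∀ v, Tendsto (fun k : ℕ => ((k : ℂ) + 1) *
        (Complex.exp (levyExponent α S Q v / ((k : ℂ) + 1)) - 1)) atTop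
        (𝓝 (levyExponent α S Q v)) := fun v =>
      tendsto_succ_mul_exp_div_sub_one tendsto_const_nhds
    refine (((hl θ).sub ((hl (θ + u)).const_mul (1 / 2))).sub
      ((hl (θ - u)).const_mul (1 / 2))).congr fun k => ?_
    ring

/-! ### Mass of the roots away from and near the zeros of `∑ j, (1 - cos (z j))` -/

/-- A nonnegative function on `ℝ^d` that vanishes exactly on the lattice `(2πℤ)^d`. -/
def latticeGap (z : EuclideanSpace ℝ (Fin d)) : ℝ := ∑ j, (1 - Real.cos (z j))

@[fun_prop] lemma continuous_latticeGap : Continuous (latticeGap (d := d)) := by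
  unfold latticeGap; fun_prop

lemma latticeGap_nonneg (z : EuclideanSpace ℝ (Fin d)) : 0 ≤ latticeGap z :=
  Finset.sum_nonneg fun _ _ => sub_nonneg.2 (Real.cos_le_one _)

/-- The points outside the open unit ball that are close to the lattice `(2πℤ)^d`. -/
def nearLattice (d : ℕ) (δ : ℝ) : Set (EuclideanSpace ℝ (Fin d)) :=
  {z | 1 ≤ ‖z‖ ∧ latticeGap z ≤ δ}

lemma isClosed_nearLattice (δ : ℝ) : IsClosed (nearLattice d δ) :=
  (isClosed_le continuous_const continuous_norm).inter
    (isClosed_le continuous_latticeGap continuous_const)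

lemma third_le_weight_of_mem_nearLattice {δ : ℝ} {z : EuclideanSpace ℝ (Fin d)}
    (hz : z ∈ nearLattice d δ) : 1 / 3 ≤ weight z := by
  have := min_le_weight z
  rw [min_eq_left (one_le_pow₀ hz.1)] at this
  linarith

/-- Away from the nonzero points of the lattice, the weight is controlled by `latticeGap`. -/
lemma weight_le_latticeGap_add_indicator {δ : ℝ} (hδ : 0 < δ) (z : EuclideanSpace ℝ (Fin d)) :
    weight z ≤ (5 + 1 / δ) * latticeGap z + (nearLattice d δ).indicator 1 z := by
  have hg := latticeGap_nonneg z
  have hi : 0 ≤ (nearLattice d δ).indicator (1 : EuclideanSpace ℝ (Fin d) → ℝ) z :=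
    Set.indicator_nonneg (fun _ _ => zero_le_one) _
  have hδ' : 0 ≤ 1 / δ * latticeGap z := by positivity
  rcases lt_or_ge ‖z‖ 1 with h | h
  · have h1 : ‖z‖ ^ 2 ≤ 5 * latticeGap z := by
      rw [EuclideanSpace.norm_sq_eq, latticeGap, Finset.mul_sum]
      refine Finset.sum_le_sum fun j _ => ?_
      have hj : |z j| ≤ 1 := (PiLp.norm_apply_le z j).trans h.le
      -- on `[-1, 1]` one has `x² ≤ (π² / 2) (1 - cos x)`, and `π² / 2 < 5`
      have h1 := Real.cos_le_one_sub_mul_cos_sq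
        (hj.trans (by linarith [Real.pi_gt_three] : (1 : ℝ) ≤ Real.pi))
      have h2 : (1 : ℝ) / 5 ≤ 2 / Real.pi ^ 2 := by
        rw [div_le_div_iff₀ (by norm_num) (by positivity)]
        nlinarith [Real.pi_lt_d2, Real.pi_pos]
      have h3 := mul_le_mul_of_nonneg_right h2 (sq_nonneg (z j))
      rw [Real.norm_eq_abs, sq_abs]
      linarith
    have := weight_le_min z
    have := min_le_right 1 (‖z‖ ^ 2)
    nlinarith
  · by_cases hz : latticeGap z ≤ δ
    · have hmem : z ∈ nearLattice d δ := ⟨h, hz⟩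
      rw [Set.indicator_of_mem hmem]
      have := weight_le_one z
      simp only [Pi.one_apply]
      nlinarith
    · have : 1 ≤ 1 / δ * latticeGap z := by
        rw [one_div, ← div_eq_inv_mul, one_le_div hδ]; exact (not_le.1 hz).le
      have := weight_le_one z
      nlinarith

lemma tendsto_weightedLimit_nearLattice (hQ : IsLevyMeasure Q)
    (hnull : Q {x | ∃ j : Fin d, ∃ a : ℤ, x j = 2 * Real.pi * (a : ℝ)} = 0) :
    Tendsto (fun n : ℕ => weightedLimit S Q (nearLattice d (1 / ((n : ℝ) + 1)))) atTop (𝓝 0) := by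
  have hfin := isFiniteMeasure_weightedLimit (S := S) hQ
  have h := tendsto_measure_iInter_atTop (μ := weightedLimit S Q)
    (s := fun n : ℕ => nearLattice d (1 / ((n : ℝ) + 1)))
    (fun n => (isClosed_nearLattice _).measurableSet.nullMeasurableSet)
    (fun m n hmn z hz => ⟨hz.1, hz.2.trans (Nat.one_div_le_one_div hmn)⟩)
    ⟨0, measure_ne_top _ _⟩
  have hsub : (⋂ n : ℕ, nearLattice d (1 / ((n : ℝ) + 1)))
      ⊆ {x | x ≠ 0} ∩ {x | ∃ j : Fin d, ∃ a : ℤ, x j = 2 * Real.pi * (a : ℝ)} := by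
    intro z hz
    rw [Set.mem_iInter] at hz
    have hz0 : z ≠ 0 := by
      rintro rfl
      have := (hz 0).1
      rw [norm_zero] at this
      linarith
    refine ⟨hz0, ?_⟩
    have hgap : latticeGap z ≤ 0 :=
      ge_of_tendsto tendsto_one_div_add_atTop_nhds_zero_nat (Eventually.of_forall fun n => (hz n).2)
    obtain ⟨j, -⟩ : ∃ j, z j ≠ 0 := by
      by_contra! hcon
      exact hz0 (by ext j; simpa using hcon j)
    have hj : 1 - Real.cos (z j) ≤ 0 := (Finset.single_le_sum (f := fun j => 1 - Real.cos (z j))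
      (fun _ _ => sub_nonneg.2 (Real.cos_le_one _)) (Finset.mem_univ j)).trans hgap
    have hcos : Real.cos (z j) = 1 := le_antisymm (Real.cos_le_one _) (by linarith)
    obtain ⟨a, ha⟩ := (Real.cos_eq_one_iff _).1 hcos
    exact ⟨j, a, by rw [← ha]; ring⟩
  have hzero : weightedLimit S Q (⋂ n : ℕ, nearLattice d (1 / ((n : ℝ) + 1))) = 0 := by
    refine measure_mono_null hsub ?_
    rw [weightedLimit, Measure.add_apply, Measure.smul_apply]
    have h1 : weighted Q 1 ({x | x ≠ 0} ∩
        {x | ∃ j : Fin d, ∃ a : ℤ, x j = 2 * Real.pi * (a : ℝ)}) = 0 :=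
      measure_mono_null Set.inter_subset_right (withDensity_absolutelyContinuous _ _ hnull)
    have h2 : Measure.dirac (0 : EuclideanSpace ℝ (Fin d)) ({x | x ≠ 0} ∩
        {x | ∃ j : Fin d, ∃ a : ℤ, x j = 2 * Real.pi * (a : ℝ)}) = 0 := by
      refine measure_mono_null (t := {0}ᶜ) Set.inter_subset_left ?_
      rw [Measure.dirac_apply' _ (measurableSet_singleton (0 : EuclideanSpace ℝ (Fin d))).compl]
      simp
    rw [h1, h2]; simp
  rw [hzero] at h
  exact h

lemma exists_bound_integral_weight_root (hS : S.PosSemidef) (hQ : IsLevyMeasure Q)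
    [∀ k, IsProbabilityMeasure (ρ k)]
    (hρ : ∀ (k : ℕ) θ, ∫ z, expI (inner ℝ θ z) ∂ρ k
      = Complex.exp (levyExponent α S Q θ / ((k : ℂ) + 1))) :
    ∃ C : ℝ, ∀ k : ℕ, ((k : ℝ) + 1) * ∫ z, weight z ∂ρ k ≤ C := by
  have h := (tendsto_charFun_weighted_root hS hQ hρ 0).norm.bddAbove_range
  obtain ⟨C, hC⟩ := h
  refine ⟨C, fun k => ?_⟩
  have := hC ⟨k, rfl⟩
  simp only at this
  rw [charFun_weighted _ (by positivity)] at this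
  simp only [inner_zero_left, expI_zero, one_mul] at this
  rw [integral_complex_ofReal, ← Complex.ofReal_mul, Complex.norm_real] at this
  exact (le_abs_self _).trans this

/-- Since the Lévy measure does not charge the lattice, the roots put little mass, after rescaling,
near its nonzero points. -/
lemma exists_eventually_root_nearLattice_le (hS : S.PosSemidef) (hQ : IsLevyMeasure Q)
    (hnull : Q {x | ∃ j : Fin d, ∃ a : ℤ, x j = 2 * Real.pi * (a : ℝ)} = 0)
    [∀ k, IsProbabilityMeasure (ρ k)]
    (hρ : ∀ (k : ℕ) θ, ∫ z, expI (inner ℝ θ z) ∂ρ k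
      = Complex.exp (levyExponent α S Q θ / ((k : ℂ) + 1))) {ε : ℝ} (hε : 0 < ε) :
    ∃ δ > 0, ∀ᶠ k : ℕ in atTop, ((k : ℝ) + 1) * (ρ k).real (nearLattice d δ) ≤ ε := by
  have hfin0 := isFiniteMeasure_weightedLimit (S := S) hQ
  have hfin : ∀ k : ℕ, IsFiniteMeasure (weighted (ρ k) ((k : ℝ) + 1)) := fun k =>
    isFiniteMeasure_weighted (integrable_min_of_isFiniteMeasure _) _
  obtain ⟨n, hn⟩ := ((tendsto_weightedLimit_nearLattice (S := S) hQ hnull).eventually_lt_const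
    (ENNReal.ofReal_pos.2 (by positivity : 0 < ε / 3))).exists
  refine ⟨1 / ((n : ℝ) + 1), Nat.one_div_pos_of_nat, ?_⟩
  let M : ℕ → FiniteMeasure (EuclideanSpace ℝ (Fin d)) := fun k =>
    ⟨weighted (ρ k) ((k : ℝ) + 1), hfin k⟩
  let M₀ : FiniteMeasure (EuclideanSpace ℝ (Fin d)) := ⟨weightedLimit S Q, hfin0⟩
  have hlim : Tendsto M atTop (𝓝 M₀) :=
    tendsto_finiteMeasure_of_tendsto_charFun fun t => tendsto_charFun_weighted_root hS hQ hρ t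
  have hsup := (FiniteMeasure.limsup_measure_closed_le_of_tendsto hlim
    (isClosed_nearLattice (1 / ((n : ℝ) + 1)))).trans_lt hn
  filter_upwards [eventually_lt_of_limsup_lt hsup] with k hk
  have hk' : weighted (ρ k) ((k : ℝ) + 1) (nearLattice d (1 / ((n : ℝ) + 1)))
      < ENNReal.ofReal (ε / 3) := hk
  rw [weighted, withDensity_apply _ (isClosed_nearLattice _).measurableSet] at hk'
  have hlow : ENNReal.ofReal (((k : ℝ) + 1) * (1 / 3)) * ρ k (nearLattice d (1 / ((n : ℝ) + 1)))
      ≤ ∫⁻ z in nearLattice d (1 / ((n : ℝ) + 1)),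
        ENNReal.ofReal (((k : ℝ) + 1) * weight z) ∂ρ k := by
    rw [← setLIntegral_const]
    refine setLIntegral_mono (by fun_prop) fun z hz => ENNReal.ofReal_le_ofReal ?_
    gcongr
    exact third_le_weight_of_mem_nearLattice hz
  have := (hlow.trans_lt hk').le
  rw [← ofReal_measureReal, ← ENNReal.ofReal_mul (by positivity),
    ENNReal.ofReal_le_ofReal_iff (by positivity)] at this
  linarith

end

/-! ### Lifting asymptotic factorization to convolution roots -/

/-- A pointwise convergent sequence of functions with a common modulus of continuity converges
uniformly on compact intervals. -/
lemma tendstoUniformlyOn_Icc_of_modulus {F : ℕ → ℝ → ℂ} {f : ℝ → ℂ} {m : ℝ → ℝ}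
    (hf : Continuous f) (hm : Continuous m) (hm0 : m 0 = 0)
    (hF : ∀ k x y, ‖F k x - F k y‖ ≤ m (x - y))
    (hlim : ∀ x, Tendsto (fun k => F k x) atTop (𝓝 (f x))) :
    TendstoUniformlyOn F f atTop (Set.Icc 0 1) := by
  rw [← tendstoLocallyUniformlyOn_iff_tendstoUniformlyOn_of_compact isCompact_Icc,
    Metric.tendstoLocallyUniformlyOn_iff]
  intro ε hε x _
  have h1 : ∀ᶠ y in 𝓝 x, m (x - y) < ε / 3 := by
    have : ContinuousAt (fun y => m (x - y)) x := by fun_prop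
    exact this.eventually_lt_const (by simpa [hm0] using by positivity)
  have h2 : ∀ᶠ y in 𝓝 x, dist (f y) (f x) < ε / 3 :=
    Metric.tendsto_nhds.1 hf.continuousAt _ (by positivity)
  refine ⟨_, mem_nhdsWithin_of_mem_nhds (h1.and h2), ?_⟩
  filter_upwards [Metric.tendsto_nhds.1 (hlim x) (ε / 3) (by positivity)] with k hk y hy
  have h3 := hF k x y
  have h4 : dist (F k x) (F k y) < ε / 3 := by rw [dist_eq_norm]; exact h3.trans_lt hy.1
  have h5 := dist_triangle4 (f y) (f x) (F k x) (F k y)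
  rw [dist_comm (f x)] at h5
  linarith [hy.2]

section Lift

variable {Ω T : Type*} [MeasurableSpace Ω] [MeasurableSpace T] {P : Measure Ω}
  [IsProbabilityMeasure P] {ν : ℕ → Measure T} [∀ k, IsProbabilityMeasure (ν k)]
  {x : Ω → ℝ} {v : ℕ → Ω → ℝ} {y z : T → ℝ} {a : ℝ → ℂ} {b : ℂ}

lemma norm_integral_expI_add_sub_le (hx : Measurable x) (hv : ∀ k, Measurable (v k))
    (k : ℕ) (s t : ℝ) :
    ‖(∫ ω, expI (s * x ω + v k ω) ∂P) - ∫ ω, expI (t * x ω + v k ω) ∂P‖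
      ≤ ∫ ω, ‖expI ((s - t) * x ω) - 1‖ ∂P := by
  have := hv k
  rw [← integral_sub (integrable_expI_comp (by fun_prop)) (integrable_expI_comp (by fun_prop))]
  refine (norm_integral_le_integral_norm _).trans (le_of_eq ?_)
  refine integral_congr_ae (Eventually.of_forall fun ω => ?_)
  have e : expI (s * x ω + v k ω) - expI (t * x ω + v k ω)
      = expI (t * x ω + v k ω) * (expI ((s - t) * x ω) - 1) := by
    rw [mul_sub, ← expI_add]; ring_nf
  simp only [e, norm_mul, norm_expI, one_mul]

/-- Let `ν k` be a `(k + 1)`-st convolution root of the law of `(x, v k)`, with coordinates `y` and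
`z`. If the characteristic functions of `(x, v k)` factorize asymptotically along a ray in the first
variable, then the covariance of the characters of `y` and `z` under the root is `o(1 / k)`.

Factorization is uniform along a segment of the ray, so the quotient by the product stays near `1`,
its principal logarithm is continuous there, and the root of the quotient is determined by it. -/
lemma tendsto_succ_mul_integral_expI_sub_one_mul (hx : Measurable x) (hv : ∀ k, Measurable (v k))
    (hy : Measurable y) (hz : Measurable z) (ha : Continuous a) (ha0 : a 0 = 0)
    (hroot : ∀ (k : ℕ) (τ : ℝ),
      (∫ t, expI (τ * y t + z t) ∂ν k) ^ (k + 1) = ∫ ω, expI (τ * x ω + v k ω) ∂P)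
    (hya : ∀ (k : ℕ), ∫ t, expI (y t) ∂ν k = Complex.exp (a 1 / ((k : ℂ) + 1)))
    (hzb : ∀ (k : ℕ), ∫ t, expI (z t) ∂ν k = Complex.exp (b / ((k : ℂ) + 1)))
    (hlim : ∀ τ : ℝ, Tendsto (fun k => ∫ ω, expI (τ * x ω + v k ω) ∂P) atTop
      (𝓝 (Complex.exp (a τ) * Complex.exp b))) :
    Tendsto (fun k : ℕ => ((k : ℂ) + 1) * ∫ t, (expI (y t) - 1) * (expI (z t) - 1) ∂ν k)
      atTop (𝓝 0) := by
  have hk0 : ∀ k : ℕ, ((k : ℂ) + 1) ≠ 0 := fun k => by exact_mod_cast k.succ_ne_zero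
  set R : ℕ → ℝ → ℂ := fun k τ => (∫ ω, expI (τ * x ω + v k ω) ∂P) * Complex.exp (-(a τ + b))
    with hR
  set r : ℕ → ℝ → ℂ := fun k τ =>
    (∫ t, expI (τ * y t + z t) ∂ν k) * Complex.exp (-((a τ + b) / ((k : ℂ) + 1))) with hr
  have hrR : ∀ k τ, r k τ ^ (k + 1) = R k τ := by
    intro k τ
    simp only [hr, hR, mul_pow, hroot, ← Complex.exp_nat_mul]
    congr 2
    push_cast
    have := hk0 k
    field_simp
  have hr0 : ∀ k, r k 0 = 1 := by
    intro k
    simp only [hr, zero_mul, zero_add, hzb, ha0, ← Complex.exp_add, add_neg_cancel,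
      Complex.exp_zero]
  have hrc : ∀ k, Continuous (r k) := by
    intro k
    refine Continuous.mul ?_ (by fun_prop)
    refine continuous_of_dominated (bound := fun _ => 1)
      (fun τ => (measurable_expI.comp (by fun_prop)).aestronglyMeasurable)
      (fun τ => by simp) (integrable_const _) (Eventually.of_forall fun t => by fun_prop)
  have hRc : ∀ k, Continuous (R k) := fun k => by
    simp only [funext (fun τ => (hrR k τ).symm)]
    exact (hrc k).pow _
  have hunif : TendstoUniformlyOn (fun k (τ : ℝ) => ∫ ω, expI (τ * x ω + v k ω) ∂P)
      (fun τ => Complex.exp (a τ) * Complex.exp b) atTop (Set.Icc 0 1) := by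
    refine tendstoUniformlyOn_Icc_of_modulus (m := fun s => ∫ ω, ‖expI (s * x ω) - 1‖ ∂P)
      (by fun_prop) ?_ (by simp) (norm_integral_expI_add_sub_le hx hv) hlim
    refine continuous_of_dominated (bound := fun _ => 2) (fun s => ?_)
      (fun s => Eventually.of_forall fun ω => ?_) (integrable_const _)
      (Eventually.of_forall fun ω => by fun_prop)
    · exact (((measurable_expI.comp (by fun_prop)).sub_const 1).norm).aestronglyMeasurable
    · rw [norm_norm]; exact norm_expI_sub_one_le_two _
  obtain ⟨B, hB⟩ := (isCompact_Icc (a := (0 : ℝ)) (b := 1)).exists_bound_of_continuousOn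
    (f := fun τ => Complex.exp (-(a τ + b))) (by fun_prop)
  have hB0 : 0 ≤ B := (norm_nonneg _).trans (hB 0 (by simp))
  have hnear : ∀ᶠ k in atTop, ∀ τ ∈ Set.Icc (0 : ℝ) 1, ‖R k τ - 1‖ < 1 := by
    filter_upwards [Metric.tendstoUniformlyOn_iff.1 hunif (1 / (B + 1)) (by positivity)]
      with k hk τ hτ
    have h1 := hk τ hτ
    rw [dist_comm, dist_eq_norm] at h1
    have e : R k τ - 1 = ((∫ ω, expI (τ * x ω + v k ω) ∂P)
        - Complex.exp (a τ) * Complex.exp b) * Complex.exp (-(a τ + b)) := by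
      simp only [hR]
      rw [sub_mul, ← Complex.exp_add, ← Complex.exp_add, add_neg_cancel, Complex.exp_zero]
    rw [e, norm_mul]
    calc _ ≤ 1 / (B + 1) * B := by gcongr; exact hB τ hτ
      _ < 1 := by rw [one_div, ← div_eq_inv_mul, div_lt_one (by positivity)]; linarith
  have hslit : ∀ w : ℂ, ‖w - 1‖ < 1 → w ∈ Complex.slitPlane := fun w hw =>
    Complex.ball_one_subset_slitPlane (by rwa [Metric.mem_ball, dist_eq_norm])
  have hlog : ∀ᶠ k in atTop, r k 1 = Complex.exp (Complex.log (R k 1) / ((k : ℂ) + 1)) := by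
    filter_upwards [hnear] with k hk
    have hR0 : R k 0 = 1 := by rw [← hrR, hr0, one_pow]
    have := eqOn_exp_div_of_pow_eq_exp (n := k + 1) k.succ_ne_zero (hrc k).continuousOn
      (L := fun τ => Complex.log (R k τ))
      ((hRc k).continuousOn.clog fun τ hτ => hslit _ (hk τ hτ))
      (fun τ hτ => by rw [hrR, Complex.exp_log (Complex.slitPlane_ne_zero (hslit _ (hk τ hτ)))])
      (hr0 k) (by simp [hR0]) 1 (by simp)
    simpa using this
  have hR1 : Tendsto (fun k => R k 1) atTop (𝓝 1) := by
    have := (hlim 1).mul_const (Complex.exp (-(a 1 + b)))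
    rwa [← Complex.exp_add, ← Complex.exp_add, add_neg_cancel, Complex.exp_zero] at this
  have hlog0 : Tendsto (fun k => Complex.log (R k 1)) atTop (𝓝 0) := by
    simpa using hR1.clog (by simp)
  have hr1 : Tendsto (fun k : ℕ => ((k : ℂ) + 1) * (r k 1 - 1)) atTop (𝓝 0) := by
    refine (tendsto_succ_mul_exp_div_sub_one hlog0).congr' ?_
    filter_upwards [hlog] with k hk
    rw [hk]
  have hexp1 : ∀ c : ℂ, Tendsto (fun k : ℕ => Complex.exp (c / ((k : ℂ) + 1))) atTop (𝓝 1) := by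
    intro c
    have h1 : Tendsto (fun k : ℕ => c / ((k : ℂ) + 1)) atTop (𝓝 0) := by
      have := (tendsto_one_div_add_atTop_nhds_zero_nat (𝕜 := ℂ)).const_mul c
      simpa [div_eq_mul_inv] using this
    simpa [Function.comp_def] using (Complex.continuous_exp.tendsto 0).comp h1
  have hA := tendsto_succ_mul_exp_div_sub_one (tendsto_const_nhds (x := a 1) (f := atTop (α := ℕ)))
  have hfin := (hr1.mul (hexp1 (a 1 + b))).add (hA.mul ((hexp1 b).sub_const 1))
  rw [zero_mul, sub_self, mul_zero, add_zero] at hfin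
  refine hfin.congr fun k => ?_
  have e : ∀ t, (expI (y t) - 1) * (expI (z t) - 1)
      = expI (1 * y t + z t) - expI (y t) - expI (z t) + 1 := by
    intro t
    rw [one_mul, expI_add]; ring
  have hi1 : Integrable (fun t => expI (1 * y t + z t)) (ν k) :=
    integrable_expI_comp (by fun_prop)
  have hi2 : Integrable (fun t => expI (y t)) (ν k) := integrable_expI_comp hy
  have hi3 : Integrable (fun t => expI (z t)) (ν k) := integrable_expI_comp hz
  have hi12 : Integrable (fun t => expI (1 * y t + z t) - expI (y t)) (ν k) := hi1.sub hi2
  have hi123 : Integrable (fun t => expI (1 * y t + z t) - expI (y t) - expI (z t)) (ν k) :=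
    hi12.sub hi3
  simp only [e]
  rw [integral_add hi123 (integrable_const _), integral_sub hi12 hi3, integral_sub hi1 hi2, hya,
    hzb]
  have hrk : ∫ t, expI (1 * y t + z t) ∂ν k
      = r k 1 * Complex.exp ((a 1 + b) / ((k : ℂ) + 1)) := by
    simp only [hr]
    rw [mul_assoc, ← Complex.exp_add, neg_add_cancel, Complex.exp_zero, mul_one]
  rw [hrk, add_div, Complex.exp_add]
  simp
  ring

end Lift

/-! ### Asymptotic factorization against one coordinate of the field -/

section Field

variable {Ω : Type*} [MeasurableSpace Ω] {P : Measure Ω} {l d : ℕ}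
  {X : (Fin l → ℝ) → Ω → EuclideanSpace ℝ (Fin d)}

lemma IsStrictlyStationary.integral_comp_eq (hstat : IsStrictlyStationary P X)
    (hmeas : ∀ t, Measurable (X t)) {m : ℕ} (s : Fin m → (Fin l → ℝ)) (h : Fin l → ℝ)
    {F : (Fin m → EuclideanSpace ℝ (Fin d)) → ℂ} (hF : Measurable F) :
    ∫ ω, F (fun i => X (s i + h) ω) ∂P = ∫ ω, F (fun i => X (s i) ω) ∂P := by
  have := congrArg (fun μ => ∫ x, F x ∂μ) (hstat m s h)
  simp only [jointLaw] at this
  rwa [integral_map (by fun_prop) hF.aestronglyMeasurable,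
    integral_map (by fun_prop) hF.aestronglyMeasurable] at this

lemma IsStrictlyStationary.integral_comp_eq_zero (hstat : IsStrictlyStationary P X)
    (hmeas : ∀ t, Measurable (X t)) (t : Fin l → ℝ)
    {F : EuclideanSpace ℝ (Fin d) → ℂ} (hF : Measurable F) :
    ∫ ω, F (X t ω) ∂P = ∫ ω, F (X 0 ω) ∂P := by
  simpa using hstat.integral_comp_eq hmeas (m := 1) (fun _ => 0) t (F := fun x => F (x 0))
    (by fun_prop)

lemma add_mem_escapingSeq {t : ℕ → (Fin l → ℝ)} (ht : t ∈ EscapingSeq l) (p : Fin l → ℝ) :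
    (fun n => p + t n) ∈ EscapingSeq l := by
  have h1 : Tendsto (fun n => ‖t n‖ - ‖p‖) atTop atTop := tendsto_atTop_add_const_right _ _ ht
  refine tendsto_atTop_mono (fun n => ?_) h1
  have := norm_sub_le (p + t n) p
  rw [add_sub_cancel_left] at this
  linarith

/-- The condition `𝔼 exp (i (X_t - X_0)) → |𝔼 exp (i X_0)|²` says that the centred variables
`exp (i X_t)` become orthogonal as `t` escapes; hence they tend weakly to zero in `L²`. -/
lemma IsStrictlyStationary.tendsto_integral_mul_expI [IsProbabilityMeasure P]
    (hstat : IsStrictlyStationary P X)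
    (hmeas : ∀ t, Measurable (X t)) {j : Fin d}
    (hcond : ∀ t ∈ EscapingSeq l, Tendsto (fun n => ∫ ω, expI (X (t n) ω j - X 0 ω j) ∂P) atTop
      (𝓝 ((∫ ω, expI (X 0 ω j) ∂P) * ∫ ω, expI (-X 0 ω j) ∂P)))
    {t : ℕ → (Fin l → ℝ)} (ht : t ∈ EscapingSeq l) {g : Ω → ℂ} (hg : Measurable g)
    (hg1 : ∀ ω, ‖g ω‖ ≤ 1) :
    Tendsto (fun n => ∫ ω, g ω * expI (X (t n) ω j) ∂P) atTop
      (𝓝 ((∫ ω, g ω ∂P) * ∫ ω, expI (X 0 ω j) ∂P)) := by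
  set c := ∫ ω, expI (X 0 ω j) ∂P with hc
  have hmj : ∀ s, Measurable fun ω => X s ω j := fun s => by
    have := hmeas s
    fun_prop
  have hcs : ∀ s, ∫ ω, expI (X s ω j) ∂P = c := fun s =>
    hstat.integral_comp_eq_zero hmeas s (F := fun x => expI (x j)) (by fun_prop)
  have hcneg : ∀ s, ∫ ω, expI (-X s ω j) ∂P = starRingEnd ℂ c := by
    intro s
    simp only [expI_neg]
    rw [integral_conj, hcs]
  have hc1 : ‖c‖ ≤ 1 := (norm_integral_le_of_norm_le_const (C := 1)
    (Eventually.of_forall fun ω => by simp)).trans (by simp)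
  have hb : ∀ s ω, ‖expI (X s ω j) - c‖ ≤ 2 := fun s ω =>
    (norm_sub_le _ _).trans (by rw [norm_expI]; linarith)
  have hL : ∀ s, MemLp (fun ω => expI (X s ω j) - c) 2 P := fun s =>
    MemLp.of_bound ((measurable_expI.comp (hmj s)).sub_const c).aestronglyMeasurable 2
      (Eventually.of_forall (hb s))
  have hgL : MemLp (fun ω => starRingEnd ℂ (g ω)) 2 P :=
    MemLp.of_bound (Complex.continuous_conj.measurable.comp hg).aestronglyMeasurable 1
      (Eventually.of_forall fun ω => by rw [RCLike.norm_conj]; exact hg1 ω)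
  have hie : ∀ s, Integrable (fun ω => expI (X s ω j)) P := fun s => integrable_expI_comp (hmj s)
  have hin : ∀ (u v : Ω → ℂ) (hu : MemLp u 2 P) (hv : MemLp v 2 P),
      inner ℂ (hu.toLp u) (hv.toLp v) = ∫ ω, starRingEnd ℂ (u ω) * v ω ∂P := by
    intro u v hu hv
    rw [L2.inner_def]
    refine integral_congr_ae ?_
    filter_upwards [hu.coeFn_toLp, hv.coeFn_toLp] with ω h1 h2
    rw [h1, h2, RCLike.inner_apply, mul_comm]
  have key := tendsto_inner_of_forall_family (fun s => (hL s).toLp _) (C := 2) (fun s => by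
      refine (Lp.norm_le_of_ae_bound zero_le_two (C := 2) ?_).trans (by simp [measureUnivNNReal])
      filter_upwards [(hL s).coeFn_toLp] with ω hω
      rw [hω]; exact hb s ω) t (fun s => ?_) (hgL.toLp _)
  · simp only [hin, Complex.conj_conj] at key
    have e : ∀ n, ∫ ω, g ω * (expI (X (t n) ω j) - c) ∂P
        = (∫ ω, g ω * expI (X (t n) ω j) ∂P) - (∫ ω, g ω ∂P) * c := by
      intro n
      have hgi : Integrable g P := Integrable.of_bound hg.aestronglyMeasurable 1
        (Eventually.of_forall hg1)
      have hgi' : Integrable (fun ω => g ω * expI (X (t n) ω j)) P :=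
        Integrable.of_bound (hg.mul (measurable_expI.comp (hmj _))).aestronglyMeasurable 1
          (Eventually.of_forall fun ω => by rw [norm_mul, norm_expI, mul_one]; exact hg1 ω)
      simp only [mul_sub]
      rw [integral_sub hgi' (hgi.mul_const c), integral_mul_const]
    simp only [e] at key
    simpa using key.add_const ((∫ ω, g ω ∂P) * c)
  · -- by stationarity only the difference `t n - s` matters, and it escapes as well
    have e : ∀ n, inner ℂ ((hL s).toLp _) ((hL (t n)).toLp _)
        = (∫ ω, expI (X (-s + t n) ω j - X 0 ω j) ∂P) - c * starRingEnd ℂ c := by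
      intro n
      rw [hin]
      have e1 : ∀ ω, starRingEnd ℂ (expI (X s ω j) - c) * (expI (X (t n) ω j) - c)
          = expI (X (t n) ω j - X s ω j) - c * expI (-X s ω j)
            - starRingEnd ℂ c * (expI (X (t n) ω j) - c) := by
        intro ω
        rw [sub_eq_add_neg (X (t n) ω j), expI_add, map_sub, ← expI_neg]
        ring
      have hi1 : Integrable (fun ω => expI (X (t n) ω j - X s ω j)) P :=
        integrable_expI_comp ((hmj _).sub (hmj _))
      have hi2 : Integrable (fun ω => expI (-X s ω j)) P := integrable_expI_comp (hmj s).neg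
      have hi12 : Integrable (fun ω => expI (X (t n) ω j - X s ω j) - c * expI (-X s ω j)) P :=
        hi1.sub (hi2.const_mul c)
      have hi3 : Integrable (fun ω => expI (X (t n) ω j) - c) P :=
        (hie _).sub (integrable_const c)
      simp only [e1]
      rw [integral_sub hi12 (hi3.const_mul _), integral_sub hi1 (hi2.const_mul c),
        integral_const_mul, integral_const_mul, integral_sub (hie _) (integrable_const c), hcs,
        hcneg]
      have hst := hstat.integral_comp_eq hmeas ![-s + t n, 0] s
        (F := fun x => expI (x 0 j - x 1 j)) (by fun_prop)
      simp only [Matrix.cons_val_zero, Matrix.cons_val_one, zero_add,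
        neg_add_cancel_comm] at hst
      rw [hst]
      simp
    simp only [e]
    have := (hcond _ (add_mem_escapingSeq ht (-s))).sub_const (c * starRingEnd ℂ c)
    rwa [hcneg, sub_self] at this

/-- The same as `tendsto_integral_mul_expI` with the opposite sign in the exponent. -/
lemma IsStrictlyStationary.tendsto_integral_mul_expI_neg [IsProbabilityMeasure P]
    (hstat : IsStrictlyStationary P X)
    (hmeas : ∀ t, Measurable (X t)) {j : Fin d}
    (hcond : ∀ t ∈ EscapingSeq l, Tendsto (fun n => ∫ ω, expI (X (t n) ω j - X 0 ω j) ∂P) atTop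
      (𝓝 ((∫ ω, expI (X 0 ω j) ∂P) * ∫ ω, expI (-X 0 ω j) ∂P)))
    {t : ℕ → (Fin l → ℝ)} (ht : t ∈ EscapingSeq l) {g : Ω → ℂ} (hg : Measurable g)
    (hg1 : ∀ ω, ‖g ω‖ ≤ 1) :
    Tendsto (fun n => ∫ ω, g ω * expI (-X (t n) ω j) ∂P) atTop
      (𝓝 ((∫ ω, g ω ∂P) * ∫ ω, expI (-X 0 ω j) ∂P)) := by
  have h := hstat.tendsto_integral_mul_expI hmeas hcond ht
    (g := fun ω => starRingEnd ℂ (g ω)) (Complex.continuous_conj.measurable.comp hg)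
    (fun ω => by rw [RCLike.norm_conj]; exact hg1 ω)
  have h2 := (Complex.continuous_conj.tendsto _).comp h
  simp only [Function.comp_def, map_mul, ← integral_conj, Complex.conj_conj, ← expI_neg] at h2
  exact h2

end Field

/-! ### From pairs of coordinates to pairs of blocks -/

lemma integrable_of_measurable_of_bound {T F : Type*} [MeasurableSpace T] [NormedAddCommGroup F]
    [MeasurableSpace F] [BorelSpace F] [SecondCountableTopology F] {ν : Measure T}
    [IsFiniteMeasure ν] {f : T → F} (hf : Measurable f) {C : ℝ} (hC : ∀ t, ‖f t‖ ≤ C) :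
    Integrable f ν :=
  Integrable.of_bound hf.aestronglyMeasurable C (Eventually.of_forall hC)

section Pair

variable {T : Type*} [MeasurableSpace T] {d : ℕ} {ν : ℕ → Measure T}
  [∀ k, IsProbabilityMeasure (ν k)] {Y Z : T → EuclideanSpace ℝ (Fin d)}
  {α : EuclideanSpace ℝ (Fin d)} {S : Matrix (Fin d) (Fin d) ℝ}
  {Q : Measure (EuclideanSpace ℝ (Fin d))}

lemma exists_bound_integral_weight_comp (hS : S.PosSemidef) (hQ : IsLevyMeasure Q)
    (hYm : Measurable Y)
    (hY : ∀ (k : ℕ) u, ∫ t, expI (inner ℝ u (Y t)) ∂ν k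
      = Complex.exp (levyExponent α S Q u / ((k : ℂ) + 1))) :
    ∃ C : ℝ, ∀ k : ℕ, ((k : ℝ) + 1) * ∫ t, weight (Y t) ∂ν k ≤ C := by
  have : ∀ k, IsProbabilityMeasure ((ν k).map Y) := fun k =>
    Measure.isProbabilityMeasure_map hYm.aemeasurable
  obtain ⟨C, hC⟩ := exists_bound_integral_weight_root (ρ := fun k => (ν k).map Y) hS hQ
    (fun k u => by
      rw [integral_map hYm.aemeasurable (Continuous.aestronglyMeasurable (by fun_prop)), hY])
  refine ⟨C, fun k => ?_⟩
  have := hC k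
  rwa [integral_map hYm.aemeasurable continuous_weight.aestronglyMeasurable] at this

lemma exists_eventually_preimage_nearLattice_le (hS : S.PosSemidef) (hQ : IsLevyMeasure Q)
    (hnull : Q {x | ∃ j : Fin d, ∃ a : ℤ, x j = 2 * Real.pi * (a : ℝ)} = 0)
    (hYm : Measurable Y)
    (hY : ∀ (k : ℕ) u, ∫ t, expI (inner ℝ u (Y t)) ∂ν k
      = Complex.exp (levyExponent α S Q u / ((k : ℂ) + 1))) {ε : ℝ} (hε : 0 < ε) :
    ∃ δ > 0, ∀ᶠ k : ℕ in atTop, ((k : ℝ) + 1) * (ν k).real (Y ⁻¹' nearLattice d δ) ≤ ε := by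
  have : ∀ k, IsProbabilityMeasure ((ν k).map Y) := fun k =>
    Measure.isProbabilityMeasure_map hYm.aemeasurable
  obtain ⟨δ, hδ, h⟩ := exists_eventually_root_nearLattice_le (ρ := fun k => (ν k).map Y) hS hQ
    hnull (fun k u => by
      rw [integral_map hYm.aemeasurable (Continuous.aestronglyMeasurable (by fun_prop)), hY]) hε
  refine ⟨δ, hδ, ?_⟩
  filter_upwards [h] with k hk
  rwa [map_measureReal_apply hYm (isClosed_nearLattice δ).measurableSet] at hk

/-- Adding the two signs removes the odd part in `Z`, in particular the Gaussian covariance. -/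
lemma tendsto_succ_mul_integral_latticeGap_mul (hYm : Measurable Y) (hZm : Measurable Z)
    (hpos : ∀ a b, Tendsto (fun k : ℕ => ((k : ℂ) + 1) *
      ∫ t, (expI (Y t a) - 1) * (expI (Z t b) - 1) ∂ν k) atTop (𝓝 0))
    (hneg : ∀ a b, Tendsto (fun k : ℕ => ((k : ℂ) + 1) *
      ∫ t, (expI (Y t a) - 1) * (expI (-Z t b) - 1) ∂ν k) atTop (𝓝 0)) :
    Tendsto (fun k : ℕ => ((k : ℝ) + 1) * ∫ t, latticeGap (Y t) * latticeGap (Z t) ∂ν k)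
      atTop (𝓝 0) := by
  have hi : ∀ (k : ℕ) a b, Integrable
      (fun t => (1 - Real.cos (Y t a)) * (1 - Real.cos (Z t b))) (ν k) := by
    intro k a b
    refine integrable_of_measurable_of_bound (by fun_prop) (C := 2 * 2) fun t => ?_
    rw [norm_mul]
    have : ∀ s : ℝ, ‖1 - Real.cos s‖ ≤ 2 := fun s => by
      rw [Real.norm_eq_abs, abs_le]
      constructor <;> linarith [Real.cos_le_one s, Real.neg_one_le_cos s]
    exact mul_le_mul (this _) (this _) (norm_nonneg _) zero_le_two
  have hone : ∀ a b, Tendsto (fun k : ℕ => ((k : ℝ) + 1) *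
      ∫ t, (1 - Real.cos (Y t a)) * (1 - Real.cos (Z t b)) ∂ν k) atTop (𝓝 0) := by
    intro a b
    have h := (Complex.continuous_re.tendsto _).comp ((hpos a b).add (hneg a b))
    have h' := h.const_mul (1 / 2 : ℝ)
    simp only [add_zero, Complex.zero_re, mul_zero] at h'
    refine h'.congr fun k => ?_
    have hb : ∀ s r : ℝ, ‖(expI s - 1) * (expI r - 1)‖ ≤ 2 * 2 := fun s r => by
      rw [norm_mul]
      exact mul_le_mul (norm_expI_sub_one_le_two _) (norm_expI_sub_one_le_two _)
        (norm_nonneg _) zero_le_two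
    have i1 : Integrable (fun t => (expI (Y t a) - 1) * (expI (Z t b) - 1)) (ν k) :=
      integrable_of_measurable_of_bound (by fun_prop) fun t => hb _ _
    have i2 : Integrable (fun t => (expI (Y t a) - 1) * (expI (-Z t b) - 1)) (ν k) :=
      integrable_of_measurable_of_bound (by fun_prop) fun t => hb _ _
    have hre := integral_re (i1.add i2)
    simp only [RCLike.re_to_complex] at hre
    have e : ∀ t, (((fun t => (expI (Y t a) - 1) * (expI (Z t b) - 1))
        + fun t => (expI (Y t a) - 1) * (expI (-Z t b) - 1)) t).re
        = 2 * ((1 - Real.cos (Y t a)) * (1 - Real.cos (Z t b))) := by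
      intro t
      have h1 := expI_eq (Z t b)
      have h2 : expI (-Z t b) = Real.cos (Z t b) - Real.sin (Z t b) * Complex.I := by
        rw [expI_eq, Real.cos_neg, Real.sin_neg]; push_cast; ring
      have h3 : ((fun t => (expI (Y t a) - 1) * (expI (Z t b) - 1))
          + fun t => (expI (Y t a) - 1) * (expI (-Z t b) - 1)) t
          = ((2 * Real.cos (Z t b) - 2 : ℝ) : ℂ) * (expI (Y t a) - 1) := by
        simp only [Pi.add_apply]
        rw [h1, h2]; push_cast; ring
      rw [h3, Complex.re_ofReal_mul, Complex.sub_re, expI_re, Complex.one_re]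
      ring
    simp only [e] at hre
    rw [integral_const_mul, integral_add' i1 i2] at hre
    simp only [Function.comp_def]
    rw [← mul_add]
    have hk : ((k : ℂ) + 1) = (((k : ℝ) + 1 : ℝ) : ℂ) := by push_cast; ring
    rw [hk, Complex.re_ofReal_mul, ← hre]
    ring
  have hsum := tendsto_finsetSum Finset.univ fun a _ =>
    tendsto_finsetSum Finset.univ fun b _ => hone a b
  simp only [Finset.sum_const_zero] at hsum
  refine hsum.congr fun k => ?_
  simp only [latticeGap, Finset.sum_mul_sum]
  rw [integral_finsetSum _ fun a _ => integrable_finsetSum _ fun b _ => hi k a b, Finset.mul_sum]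
  refine Finset.sum_congr rfl fun a _ => ?_
  rw [integral_finsetSum _ fun b _ => hi k a b, Finset.mul_sum]

/-- Asymptotically the roots charge no pairs with both entries away from the origin: `latticeGap`
controls the weight except near the nonzero points of the lattice, where there is little mass. -/
lemma tendsto_succ_mul_integral_weight_mul_weight (hS : S.PosSemidef) (hQ : IsLevyMeasure Q)
    (hnull : Q {x | ∃ j : Fin d, ∃ a : ℤ, x j = 2 * Real.pi * (a : ℝ)} = 0)
    (hYm : Measurable Y) (hZm : Measurable Z)
    (hY : ∀ (k : ℕ) u, ∫ t, expI (inner ℝ u (Y t)) ∂ν k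
      = Complex.exp (levyExponent α S Q u / ((k : ℂ) + 1)))
    (hZ : ∀ (k : ℕ) u, ∫ t, expI (inner ℝ u (Z t)) ∂ν k
      = Complex.exp (levyExponent α S Q u / ((k : ℂ) + 1)))
    (hgap : Tendsto (fun k : ℕ => ((k : ℝ) + 1) *
      ∫ t, latticeGap (Y t) * latticeGap (Z t) ∂ν k) atTop (𝓝 0)) :
    Tendsto (fun k : ℕ => ((k : ℝ) + 1) * ∫ t, weight (Y t) * weight (Z t) ∂ν k)
      atTop (𝓝 0) := by
  have hnn : ∀ k : ℕ, 0 ≤ ((k : ℝ) + 1) * ∫ t, weight (Y t) * weight (Z t) ∂ν k := fun k =>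
    mul_nonneg (by positivity)
      (integral_nonneg fun t => mul_nonneg (weight_nonneg _) (weight_nonneg _))
  rw [Metric.tendsto_nhds]
  intro ε hε
  obtain ⟨δ₁, hδ₁, h1⟩ := exists_eventually_preimage_nearLattice_le hS hQ hnull hYm hY
    (ε := ε / 4) (by positivity)
  obtain ⟨δ₂, hδ₂, h2⟩ := exists_eventually_preimage_nearLattice_le hS hQ hnull hZm hZ
    (ε := ε / 4) (by positivity)
  set c₁ := 5 + 1 / δ₁
  set c₂ := 5 + 1 / δ₂
  have hc₁ : 0 < c₁ := by positivity
  have hc₂ : 0 < c₂ := by positivity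
  have hmS₁ : MeasurableSet (Y ⁻¹' nearLattice d δ₁) := hYm (isClosed_nearLattice _).measurableSet
  have hmS₂ : MeasurableSet (Z ⁻¹' nearLattice d δ₂) := hZm (isClosed_nearLattice _).measurableSet
  have hpt : ∀ t, weight (Y t) * weight (Z t) ≤ c₁ * c₂ * (latticeGap (Y t) * latticeGap (Z t))
      + (Y ⁻¹' nearLattice d δ₁).indicator 1 t + (Z ⁻¹' nearLattice d δ₂).indicator 1 t := by
    intro t
    have a1 := weight_le_latticeGap_add_indicator hδ₁ (Y t)
    have a2 := weight_le_latticeGap_add_indicator hδ₂ (Z t)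
    have b1 := weight_nonneg (Y t)
    have b2 := weight_nonneg (Z t)
    have e1 := weight_le_one (Y t)
    have e2 := weight_le_one (Z t)
    have g1 := latticeGap_nonneg (Y t)
    have g2 := latticeGap_nonneg (Z t)
    have hgg : 0 ≤ c₁ * c₂ * (latticeGap (Y t) * latticeGap (Z t)) := by positivity
    have hww : weight (Y t) * weight (Z t) ≤ 1 := mul_le_one₀ e1 b2 e2
    by_cases m1 : Y t ∈ nearLattice d δ₁
    · have i2 : 0 ≤ (Z ⁻¹' nearLattice d δ₂).indicator (1 : T → ℝ) t :=
        Set.indicator_nonneg (fun _ _ => zero_le_one) _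
      rw [Set.indicator_of_mem (show t ∈ Y ⁻¹' nearLattice d δ₁ from m1)]
      simp only [Pi.one_apply]
      linarith
    · by_cases m2 : Z t ∈ nearLattice d δ₂
      · have i1 : 0 ≤ (Y ⁻¹' nearLattice d δ₁).indicator (1 : T → ℝ) t :=
          Set.indicator_nonneg (fun _ _ => zero_le_one) _
        rw [Set.indicator_of_mem (show t ∈ Z ⁻¹' nearLattice d δ₂ from m2)]
        simp only [Pi.one_apply]
        linarith
      · rw [Set.indicator_of_notMem (show t ∉ Y ⁻¹' nearLattice d δ₁ from m1),
          Set.indicator_of_notMem (show t ∉ Z ⁻¹' nearLattice d δ₂ from m2)]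
        rw [Set.indicator_of_notMem m1] at a1
        rw [Set.indicator_of_notMem m2] at a2
        rw [add_zero] at a1 a2 ⊢
        rw [add_zero]
        calc weight (Y t) * weight (Z t) ≤ (c₁ * latticeGap (Y t)) * (c₂ * latticeGap (Z t)) := by
              gcongr
          _ = _ := by ring
  have hgb : ∀ x : EuclideanSpace ℝ (Fin d), ‖latticeGap x‖ ≤ ∑ _j : Fin d, (2 : ℝ) := by
    intro x
    rw [Real.norm_of_nonneg (latticeGap_nonneg x)]
    exact Finset.sum_le_sum fun j _ => by linarith [Real.neg_one_le_cos (x j)]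
  have hlim : ∀ᶠ k : ℕ in atTop, c₁ * c₂ * (((k : ℝ) + 1) *
      ∫ t, latticeGap (Y t) * latticeGap (Z t) ∂ν k) < ε / 4 := by
    have := hgap.const_mul (c₁ * c₂)
    rw [mul_zero] at this
    exact this.eventually_lt_const (by positivity)
  filter_upwards [h1, h2, hlim] with k hk1 hk2 hk3
  rw [dist_zero_right, Real.norm_of_nonneg (hnn k)]
  have iw : Integrable (fun t => weight (Y t) * weight (Z t)) (ν k) :=
    integrable_of_measurable_of_bound (by fun_prop) (C := 1) fun t => by
      rw [Real.norm_of_nonneg (mul_nonneg (weight_nonneg _) (weight_nonneg _))]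
      exact mul_le_one₀ (weight_le_one _) (weight_nonneg _) (weight_le_one _)
  have ig : Integrable (fun t => c₁ * c₂ * (latticeGap (Y t) * latticeGap (Z t))) (ν k) :=
    Integrable.const_mul (integrable_of_measurable_of_bound (by fun_prop) fun t => by
      rw [norm_mul]
      exact mul_le_mul (hgb _) (hgb _) (norm_nonneg _) ((norm_nonneg _).trans (hgb (Y t)))) _
  have i1 : Integrable ((Y ⁻¹' nearLattice d δ₁).indicator (1 : T → ℝ)) (ν k) :=
    (integrable_const (1 : ℝ)).indicator hmS₁
  have i2 : Integrable ((Z ⁻¹' nearLattice d δ₂).indicator (1 : T → ℝ)) (ν k) :=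
    (integrable_const (1 : ℝ)).indicator hmS₂
  have ig1 : Integrable (fun t => c₁ * c₂ * (latticeGap (Y t) * latticeGap (Z t))
      + (Y ⁻¹' nearLattice d δ₁).indicator 1 t) (ν k) := ig.add i1
  have hint := integral_mono iw (ig1.add i2) hpt
  simp only [Pi.add_apply] at hint
  rw [integral_add ig1 i2, integral_add ig i1, integral_const_mul, integral_indicator_one hmS₁,
    integral_indicator_one hmS₂] at hint
  have hk : (0 : ℝ) ≤ (k : ℝ) + 1 := by positivity
  have := mul_le_mul_of_nonneg_left hint hk
  linarith

/-- The square root of the weight is of first order at the origin, as are the increments of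
characters. -/
lemma tendsto_succ_mul_integral_sqrt_weight_mul_weight (hYm : Measurable Y) (hZm : Measurable Z)
    (hbd : ∃ C : ℝ, ∀ k : ℕ, ((k : ℝ) + 1) * ∫ t, weight (Z t) ∂ν k ≤ C)
    (hww : Tendsto (fun k : ℕ => ((k : ℝ) + 1) * ∫ t, weight (Y t) * weight (Z t) ∂ν k)
      atTop (𝓝 0)) :
    Tendsto (fun k : ℕ => ((k : ℝ) + 1) * ∫ t, √(weight (Y t)) * weight (Z t) ∂ν k)
      atTop (𝓝 0) := by
  obtain ⟨C, hC⟩ := hbd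
  rw [Metric.tendsto_nhds]
  intro ε hε
  set δ := ε / (2 * (|C| + 1)) with hδ
  have hδ0 : 0 < δ := by positivity
  have h1 : ∀ᶠ k : ℕ in atTop,
      δ⁻¹ * (((k : ℝ) + 1) * ∫ t, weight (Y t) * weight (Z t) ∂ν k) < ε / 2 := by
    have := hww.const_mul δ⁻¹
    rw [mul_zero] at this
    exact this.eventually_lt_const (by positivity)
  filter_upwards [h1] with k hk1
  have hk : (0 : ℝ) ≤ (k : ℝ) + 1 := by positivity
  -- this is `δ * w ≤ δ ^ 2 + w ^ 2` for `w = √(weight x)`, divided by `δ`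
  have hsq : ∀ x : EuclideanSpace ℝ (Fin d), √(weight x) ≤ δ + δ⁻¹ * weight x := by
    intro x
    have h2 := Real.sq_sqrt (weight_nonneg x)
    have h3 : √(weight x) = δ⁻¹ * (δ * √(weight x)) := by field_simp
    have h4 : δ = δ⁻¹ * δ ^ 2 := by field_simp
    nth_rewrite 1 [h4]
    rw [h3, ← h2, ← mul_add, Real.sqrt_sq (Real.sqrt_nonneg _)]
    gcongr
    nlinarith [sq_nonneg (δ - √(weight x)), sq_nonneg δ, sq_nonneg √(weight x)]
  have iw : Integrable (fun t => weight (Z t)) (ν k) :=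
    integrable_of_measurable_of_bound (by fun_prop) (C := 1) fun t => by
      rw [Real.norm_of_nonneg (weight_nonneg _)]; exact weight_le_one _
  have iww : Integrable (fun t => weight (Y t) * weight (Z t)) (ν k) :=
    integrable_of_measurable_of_bound (by fun_prop) (C := 1) fun t => by
      rw [Real.norm_of_nonneg (mul_nonneg (weight_nonneg _) (weight_nonneg _))]
      exact mul_le_one₀ (weight_le_one _) (weight_nonneg _) (weight_le_one _)
  have isw : Integrable (fun t => √(weight (Y t)) * weight (Z t)) (ν k) :=
    integrable_of_measurable_of_bound (by fun_prop) (C := 1) fun t => by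
      rw [Real.norm_of_nonneg (mul_nonneg (Real.sqrt_nonneg _) (weight_nonneg _))]
      exact mul_le_one₀ (Real.sqrt_le_one.2 (weight_le_one _)) (weight_nonneg _) (weight_le_one _)
  have hint := integral_mono isw ((iw.const_mul δ).add (iww.const_mul δ⁻¹)) (fun t => by
    have := mul_le_mul_of_nonneg_right (hsq (Y t)) (weight_nonneg (Z t))
    simp only [Pi.add_apply]
    linarith)
  rw [integral_add' (iw.const_mul δ) (iww.const_mul δ⁻¹), integral_const_mul,
    integral_const_mul] at hint
  rw [dist_zero_right, Real.norm_of_nonneg (mul_nonneg hk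
    (integral_nonneg fun t => mul_nonneg (Real.sqrt_nonneg _) (weight_nonneg _)))]
  have h5 := mul_le_mul_of_nonneg_left hint hk
  have h6 : δ * (((k : ℝ) + 1) * ∫ t, weight (Z t) ∂ν k) ≤ ε / 2 := by
    calc _ ≤ δ * (|C| + 1) := by
          gcongr
          exact (hC k).trans ((le_abs_self C).trans (by linarith))
      _ = ε / 2 := by rw [hδ]; field_simp
  linarith

end Pair

/-! ### Several blocks -/

section Blocks

variable {d m : ℕ}

/-- The increment `exp (i ∑ ⟪θ q, y q⟫) - 1` of a character in several blocks of variables. -/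
def charIncr (θ y : Fin m → EuclideanSpace ℝ (Fin d)) : ℂ := expI (∑ q, inner ℝ (θ q) (y q)) - 1

/-- The linear combination of the increments `exp (i (y q a)) - 1` of the coordinate characters that
approximates `charIncr θ y` to second order. -/
def linIncr (θ y : Fin m → EuclideanSpace ℝ (Fin d)) : ℂ :=
  ∑ i : Fin m × Fin d, (θ i.1 i.2 : ℂ) * (expI (y i.1 i.2) - 1)

lemma measurable_charIncr (θ : Fin m → EuclideanSpace ℝ (Fin d)) : Measurable (charIncr θ) := by
  unfold charIncr; fun_prop

lemma measurable_linIncr (θ : Fin m → EuclideanSpace ℝ (Fin d)) : Measurable (linIncr θ) := by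
  unfold linIncr; fun_prop

lemma weight_le_sqrt_weight (x : EuclideanSpace ℝ (Fin d)) : weight x ≤ √(weight x) := by
  refine Real.le_sqrt_of_sq_le ?_
  nlinarith [weight_nonneg x, weight_le_one x]

lemma norm_expI_coord_sub_one_le (x : EuclideanSpace ℝ (Fin d)) (a : Fin d) :
    ‖expI (x a) - 1‖ ≤ 4 * √(weight x) := by
  rw [← pow_le_pow_iff_left₀ (norm_nonneg _) (by positivity) two_ne_zero, mul_pow,
    Real.sq_sqrt (weight_nonneg x)]
  have h1 := min_le_weight x
  have h2 : ‖expI (x a) - 1‖ ^ 2 ≤ 4 * min 1 (‖x‖ ^ 2) := by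
    rcases le_total 1 (‖x‖ ^ 2) with h | h
    · rw [min_eq_left h]
      have := norm_expI_sub_one_le_two (x a)
      nlinarith [norm_nonneg (expI (x a) - 1)]
    · rw [min_eq_right h]
      have h3 : ‖expI (x a) - 1‖ ≤ ‖x‖ := (norm_expI_sub_one_le _).trans (PiLp.norm_apply_le x a)
      nlinarith [norm_nonneg (expI (x a) - 1), norm_nonneg x]
  have := weight_nonneg x
  linarith

lemma exists_linIncr_bounds (θ : Fin m → EuclideanSpace ℝ (Fin d)) :
    ∃ C : ℝ, 0 ≤ C ∧ ∀ y, ‖charIncr θ y - linIncr θ y‖ ≤ C * ∑ q, weight (y q) ∧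
      ‖linIncr θ y‖ ≤ C * ∑ q, √(weight (y q)) ∧ ‖charIncr θ y‖ ≤ C * ∑ q, √(weight (y q)) := by
  obtain ⟨C₁, hC₁, h₁⟩ := norm_expI_sum_sub_one_sub_le
    (fun i : Fin m × Fin d => θ i.1 i.2)
  set A := ∑ i : Fin m × Fin d, |θ i.1 i.2| * 4 with hA
  have hA0 : 0 ≤ A := Finset.sum_nonneg fun i _ => by positivity
  have herr : ∀ y : Fin m → EuclideanSpace ℝ (Fin d),
      ‖charIncr θ y - linIncr θ y‖ ≤ (3 * C₁) * ∑ q, weight (y q) := by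
    intro y
    have e : ∑ q, (inner ℝ (θ q) (y q) : ℝ) = ∑ i : Fin m × Fin d, θ i.1 i.2 * y i.1 i.2 := by
      rw [Fintype.sum_prod_type]
      refine Finset.sum_congr rfl fun q _ => ?_
      rw [PiLp.inner_apply]
      refine Finset.sum_congr rfl fun j _ => ?_
      simp [mul_comm]
    have hq : ∑ i : Fin m × Fin d, (y i.1 i.2) ^ 2 = ∑ q, ‖y q‖ ^ 2 := by
      rw [Fintype.sum_prod_type]
      refine Finset.sum_congr rfl fun q _ => ?_
      rw [EuclideanSpace.norm_sq_eq]
      simp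
    have hmin : min 1 (∑ q, ‖y q‖ ^ 2) ≤ ∑ q, min 1 (‖y q‖ ^ 2) := by
      by_cases hex : ∃ q, 1 ≤ ‖y q‖ ^ 2
      · obtain ⟨q, hq⟩ := hex
        refine (min_le_left _ _).trans ?_
        have := Finset.single_le_sum (f := fun q => min 1 (‖y q‖ ^ 2))
          (fun q _ => by positivity) (Finset.mem_univ q)
        rwa [min_eq_left hq] at this
      · push Not at hex
        refine (min_le_right _ _).trans (Finset.sum_le_sum fun q _ => ?_)
        rw [min_eq_right (hex q).le]
    have h2 := h₁ (fun i => y i.1 i.2)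
    rw [hq] at h2
    rw [charIncr, linIncr, e]
    refine h2.trans ?_
    rw [mul_comm 3 C₁, mul_assoc, Finset.mul_sum _ _ (3 : ℝ)]
    refine mul_le_mul_of_nonneg_left (hmin.trans ?_) hC₁
    exact Finset.sum_le_sum fun q _ => min_le_weight _
  have hlin : ∀ y : Fin m → EuclideanSpace ℝ (Fin d),
      ‖linIncr θ y‖ ≤ A * ∑ q, √(weight (y q)) := by
    intro y
    rw [linIncr, hA, Finset.sum_mul]
    refine (norm_sum_le _ _).trans (Finset.sum_le_sum fun i _ => ?_)
    rw [norm_mul, Complex.norm_real, Real.norm_eq_abs, mul_assoc]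
    refine mul_le_mul_of_nonneg_left ((norm_expI_coord_sub_one_le _ _).trans ?_) (abs_nonneg _)
    gcongr
    exact Finset.single_le_sum (f := fun q => √(weight (y q)))
      (fun q _ => Real.sqrt_nonneg _) (Finset.mem_univ i.1)
  refine ⟨3 * C₁ + A, by positivity, fun y => ?_⟩
  have hw0 : 0 ≤ ∑ q, weight (y q) := Finset.sum_nonneg fun q _ => weight_nonneg _
  have hs0 : 0 ≤ ∑ q, √(weight (y q)) := Finset.sum_nonneg fun q _ => Real.sqrt_nonneg _
  have hws : ∑ q, weight (y q) ≤ ∑ q, √(weight (y q)) :=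
    Finset.sum_le_sum fun q _ => weight_le_sqrt_weight _
  have h1 := herr y
  have h2 := hlin y
  have h3 : ‖charIncr θ y‖ ≤ ‖charIncr θ y - linIncr θ y‖ + ‖linIncr θ y‖ := by
    simpa using norm_add_le (charIncr θ y - linIncr θ y) (linIncr θ y)
  have h4 : 3 * C₁ * ∑ q, weight (y q) ≤ 3 * C₁ * ∑ q, √(weight (y q)) := by gcongr
  refine ⟨?_, ?_, ?_⟩ <;> nlinarith

lemma norm_charIncr_le (θ y : Fin m → EuclideanSpace ℝ (Fin d)) : ‖charIncr θ y‖ ≤ 2 :=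
  norm_expI_sub_one_le_two _

lemma exists_norm_linIncr_le (θ : Fin m → EuclideanSpace ℝ (Fin d)) :
    ∃ C : ℝ, ∀ y, ‖linIncr θ y‖ ≤ C := by
  refine ⟨∑ i : Fin m × Fin d, |θ i.1 i.2| * 2, fun y => ?_⟩
  refine (norm_sum_le _ _).trans (Finset.sum_le_sum fun i _ => ?_)
  rw [norm_mul, Complex.norm_real, Real.norm_eq_abs]
  exact mul_le_mul_of_nonneg_left (norm_expI_sub_one_le_two _) (abs_nonneg _)

variable {T : Type*} [MeasurableSpace T] {ν : ℕ → Measure T}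
  [∀ k, IsProbabilityMeasure (ν k)] {Y Z : Fin m → T → EuclideanSpace ℝ (Fin d)}
  {α : EuclideanSpace ℝ (Fin d)} {S : Matrix (Fin d) (Fin d) ℝ}
  {Q : Measure (EuclideanSpace ℝ (Fin d))}

lemma integrable_charIncr (hYm : ∀ q, Measurable (Y q)) (θ : Fin m → EuclideanSpace ℝ (Fin d))
    (k : ℕ) : Integrable (fun t => charIncr θ fun q => Y q t) (ν k) :=
  integrable_of_measurable_of_bound ((measurable_charIncr θ).comp (by fun_prop))
    fun t => norm_charIncr_le _ _

lemma integrable_linIncr (hYm : ∀ q, Measurable (Y q)) (θ : Fin m → EuclideanSpace ℝ (Fin d))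
    (k : ℕ) : Integrable (fun t => linIncr θ fun q => Y q t) (ν k) := by
  obtain ⟨C, hC⟩ := exists_norm_linIncr_le θ
  exact integrable_of_measurable_of_bound ((measurable_linIncr θ).comp (by fun_prop))
    fun t => hC _

/-- Under the roots, increments of characters have expectation `O(1 / k)`. -/
lemma exists_bound_integral_charIncr (hYm : ∀ q, Measurable (Y q))
    (hbd : ∀ q, ∃ C : ℝ, ∀ k : ℕ, ((k : ℝ) + 1) * ∫ t, weight (Y q t) ∂ν k ≤ C)
    (hY : ∀ q (k : ℕ) u, ∫ t, expI (inner ℝ u (Y q t)) ∂ν k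
      = Complex.exp (levyExponent α S Q u / ((k : ℂ) + 1)))
    (θ : Fin m → EuclideanSpace ℝ (Fin d)) :
    ∃ C : ℝ, ∀ k : ℕ, ((k : ℝ) + 1) * ‖∫ t, charIncr θ (fun q => Y q t) ∂ν k‖ ≤ C := by
  obtain ⟨C, hC0, hC⟩ := exists_linIncr_bounds θ
  choose B hB using hbd
  have hlim : Tendsto (fun k : ℕ => ((k : ℂ) + 1) * ∫ t, linIncr θ (fun q => Y q t) ∂ν k) atTop
      (𝓝 (∑ i : Fin m × Fin d, (θ i.1 i.2 : ℂ) *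
        levyExponent α S Q (EuclideanSpace.single i.2 1))) := by
    have h := tendsto_finsetSum Finset.univ fun (i : Fin m × Fin d) _ =>
      (tendsto_succ_mul_exp_div_sub_one (tendsto_const_nhds (f := atTop (α := ℕ))
        (x := levyExponent α S Q (EuclideanSpace.single i.2 1)))).const_mul (θ i.1 i.2 : ℂ)
    refine h.congr fun k => ?_
    have hi : ∀ i : Fin m × Fin d, Integrable (fun t => expI (Y i.1 t i.2)) (ν k) := fun i =>
      integrable_expI_comp (by have := hYm i.1; fun_prop)
    have hi' : ∀ i : Fin m × Fin d,
        Integrable (fun t => (θ i.1 i.2 : ℂ) * (expI (Y i.1 t i.2) - 1)) (ν k) := fun i =>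
      ((hi i).sub (integrable_const 1)).const_mul _
    simp only [linIncr]
    rw [integral_finsetSum _ fun i _ => hi' i, Finset.mul_sum]
    refine Finset.sum_congr rfl fun i _ => ?_
    rw [integral_const_mul, integral_sub (hi i) (integrable_const 1)]
    have := hY i.1 k (EuclideanSpace.single i.2 1)
    simp only [EuclideanSpace.inner_single_left, map_one, one_mul] at this
    rw [this]
    simp
    ring
  obtain ⟨K, hK⟩ := hlim.norm.bddAbove_range
  refine ⟨K + C * ∑ q, B q, fun k => ?_⟩
  have hK' := hK ⟨k, rfl⟩
  simp only [norm_mul, norm_natCast_add_one] at hK'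
  have hk : (0 : ℝ) ≤ (k : ℝ) + 1 := by positivity
  have hic := integrable_charIncr (ν := ν) hYm θ k
  have hil := integrable_linIncr (ν := ν) hYm θ k
  have hiw : ∀ q, Integrable (fun t => weight (Y q t)) (ν k) := fun q =>
    integrable_of_measurable_of_bound (by have := hYm q; fun_prop) (C := 1) fun t => by
      rw [Real.norm_of_nonneg (weight_nonneg _)]; exact weight_le_one _
  have h1 : ‖∫ t, (charIncr θ (fun q => Y q t) - linIncr θ (fun q => Y q t)) ∂ν k‖
      ≤ C * ∑ q, ∫ t, weight (Y q t) ∂ν k := by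
    rw [← integral_finsetSum _ fun q _ => hiw q, ← integral_const_mul]
    exact norm_integral_le_of_norm_le ((integrable_finsetSum _ fun q _ => hiw q).const_mul C)
      (Eventually.of_forall fun t => (hC _).1)
  rw [integral_sub hic hil] at h1
  have h2 := norm_le_norm_sub_add (∫ t, charIncr θ (fun q => Y q t) ∂ν k)
    (∫ t, linIncr θ (fun q => Y q t) ∂ν k)
  have h3 : ((k : ℝ) + 1) * (C * ∑ q, ∫ t, weight (Y q t) ∂ν k) ≤ C * ∑ q, B q := by
    rw [mul_left_comm, Finset.mul_sum]
    gcongr with q _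
    exact hB q k
  have h4 := mul_le_mul_of_nonneg_left (h2.trans (add_le_add_left h1 _)) hk
  linarith

/-- The covariance of two characters of blocks is `o(1 / k)` under the roots, provided that this
holds for the coordinate characters of each pair of blocks. -/
lemma tendsto_succ_mul_integral_charIncr_mul (hYm : ∀ q, Measurable (Y q))
    (hZm : ∀ q, Measurable (Z q))
    (hcoord : ∀ q r a b, Tendsto (fun k : ℕ => ((k : ℂ) + 1) *
      ∫ t, (expI (Y q t a) - 1) * (expI (Z r t b) - 1) ∂ν k) atTop (𝓝 0))
    (hsw : ∀ q r, Tendsto (fun k : ℕ => ((k : ℝ) + 1) *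
      ∫ t, √(weight (Y q t)) * weight (Z r t) ∂ν k) atTop (𝓝 0))
    (hws : ∀ q r, Tendsto (fun k : ℕ => ((k : ℝ) + 1) *
      ∫ t, √(weight (Z r t)) * weight (Y q t) ∂ν k) atTop (𝓝 0))
    (θ₁ θ₂ : Fin m → EuclideanSpace ℝ (Fin d)) :
    Tendsto (fun k : ℕ => ((k : ℂ) + 1) *
      ∫ t, charIncr θ₁ (fun q => Y q t) * charIncr θ₂ (fun q => Z q t) ∂ν k) atTop (𝓝 0) := by
  obtain ⟨C₁, hC₁, h₁⟩ := exists_linIncr_bounds θ₁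
  obtain ⟨C₂, hC₂, h₂⟩ := exists_linIncr_bounds θ₂
  obtain ⟨B₁, hB₁⟩ := exists_norm_linIncr_le θ₁
  obtain ⟨B₂, hB₂⟩ := exists_norm_linIncr_le θ₂
  have hYm' : Measurable fun t => fun q => Y q t := by fun_prop
  have hZm' : Measurable fun t => fun q => Z q t := by fun_prop
  have mcY := (measurable_charIncr θ₁).comp hYm'
  have mcZ := (measurable_charIncr θ₂).comp hZm'
  have mlY := (measurable_linIncr θ₁).comp hYm'
  have mlZ := (measurable_linIncr θ₂).comp hZm'
  have icc : ∀ k, Integrable (fun t =>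
      charIncr θ₁ (fun q => Y q t) * charIncr θ₂ (fun q => Z q t)) (ν k) := fun k =>
    integrable_of_measurable_of_bound (mcY.mul mcZ) (C := 2 * 2) fun t => by
      rw [norm_mul]
      exact mul_le_mul (norm_charIncr_le _ _) (norm_charIncr_le _ _) (norm_nonneg _) zero_le_two
  have ill : ∀ k, Integrable (fun t =>
      linIncr θ₁ (fun q => Y q t) * linIncr θ₂ (fun q => Z q t)) (ν k) := fun k =>
    integrable_of_measurable_of_bound (mlY.mul mlZ) (C := B₁ * B₂) fun t => by
      rw [norm_mul]
      exact mul_le_mul (hB₁ _) (hB₂ _) (norm_nonneg _) ((norm_nonneg _).trans (hB₁ fun q => Y q t))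
  have hlin : Tendsto (fun k : ℕ => ((k : ℂ) + 1) *
      ∫ t, linIncr θ₁ (fun q => Y q t) * linIncr θ₂ (fun q => Z q t) ∂ν k) atTop (𝓝 0) := by
    have h := tendsto_finsetSum Finset.univ fun (i : Fin m × Fin d) _ =>
      tendsto_finsetSum Finset.univ fun (j : Fin m × Fin d) _ =>
        (hcoord i.1 j.1 i.2 j.2).const_mul ((θ₁ i.1 i.2 : ℂ) * (θ₂ j.1 j.2 : ℂ))
    simp only [mul_zero, Finset.sum_const_zero] at h
    refine h.congr fun k => ?_
    have hi : ∀ i j : Fin m × Fin d, Integrable (fun t =>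
        ((θ₁ i.1 i.2 : ℂ) * (expI (Y i.1 t i.2) - 1)) *
          ((θ₂ j.1 j.2 : ℂ) * (expI (Z j.1 t j.2) - 1))) (ν k) := by
      intro i j
      have := hYm i.1
      have := hZm j.1
      refine integrable_of_measurable_of_bound (by fun_prop)
        (C := (‖(θ₁ i.1 i.2 : ℂ)‖ * 2) * (‖(θ₂ j.1 j.2 : ℂ)‖ * 2)) fun t => ?_
      rw [norm_mul, norm_mul, norm_mul]
      gcongr <;> exact norm_expI_sub_one_le_two _
    simp only [linIncr, Finset.sum_mul_sum]
    rw [integral_finsetSum _ fun i _ => integrable_finsetSum _ fun j _ => hi i j, Finset.mul_sum]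
    refine Finset.sum_congr rfl fun i _ => ?_
    rw [integral_finsetSum _ fun j _ => hi i j, Finset.mul_sum]
    refine Finset.sum_congr rfl fun j _ => ?_
    have e : ∀ t, ((θ₁ i.1 i.2 : ℂ) * (expI (Y i.1 t i.2) - 1)) *
        ((θ₂ j.1 j.2 : ℂ) * (expI (Z j.1 t j.2) - 1)) = ((θ₁ i.1 i.2 : ℂ) * (θ₂ j.1 j.2 : ℂ)) *
        ((expI (Y i.1 t i.2) - 1) * (expI (Z j.1 t j.2) - 1)) := fun t => by ring
    simp only [e, integral_const_mul]
    ring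
  have hbound : Tendsto (fun k : ℕ => C₁ * C₂ * ∑ q, ∑ r,
      (((k : ℝ) + 1) * (∫ t, √(weight (Z r t)) * weight (Y q t) ∂ν k)
        + ((k : ℝ) + 1) * ∫ t, √(weight (Y q t)) * weight (Z r t) ∂ν k)) atTop (𝓝 0) := by
    have h := (tendsto_finsetSum Finset.univ fun q _ => tendsto_finsetSum Finset.univ fun r _ =>
      (hws q r).add (hsw q r)).const_mul (C₁ * C₂)
    simpa using h
  have hdiff : Tendsto (fun k : ℕ => ((k : ℂ) + 1) *
      (∫ t, charIncr θ₁ (fun q => Y q t) * charIncr θ₂ (fun q => Z q t) ∂ν k)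
      - ((k : ℂ) + 1) *
      ∫ t, linIncr θ₁ (fun q => Y q t) * linIncr θ₂ (fun q => Z q t) ∂ν k) atTop (𝓝 0) := by
    refine squeeze_zero_norm (fun k => ?_) hbound
    have isw : ∀ (U V : T → EuclideanSpace ℝ (Fin d)), Measurable U → Measurable V →
        Integrable (fun t => √(weight (U t)) * weight (V t)) (ν k) := fun U V hU hV =>
      integrable_of_measurable_of_bound (by fun_prop) (C := 1) fun t => by
        rw [Real.norm_of_nonneg (mul_nonneg (Real.sqrt_nonneg _) (weight_nonneg _))]
        exact mul_le_one₀ (Real.sqrt_le_one.2 (weight_le_one _)) (weight_nonneg _)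
          (weight_le_one _)
    have ie : ∀ q r, Integrable (fun t => √(weight (Z r t)) * weight (Y q t)
        + √(weight (Y q t)) * weight (Z r t)) (ν k) := fun q r =>
      (isw _ _ (hZm r) (hYm q)).add (isw _ _ (hYm q) (hZm r))
    have ies : Integrable (fun t => C₁ * C₂ * ∑ q, ∑ r, (√(weight (Z r t)) * weight (Y q t)
        + √(weight (Y q t)) * weight (Z r t))) (ν k) :=
      (integrable_finsetSum _ fun q _ => integrable_finsetSum _ fun r _ => ie q r).const_mul _
    rw [← mul_sub, ← integral_sub (icc k) (ill k), norm_mul, norm_natCast_add_one]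
    have hb := norm_integral_le_of_norm_le ies (μ := ν k)
      (f := fun t => charIncr θ₁ (fun q => Y q t) * charIncr θ₂ (fun q => Z q t)
        - linIncr θ₁ (fun q => Y q t) * linIncr θ₂ (fun q => Z q t))
      (Eventually.of_forall fun t => ?_)
    · have hk : (0 : ℝ) ≤ (k : ℝ) + 1 := by positivity
      refine (mul_le_mul_of_nonneg_left hb hk).trans_eq ?_
      rw [integral_const_mul, integral_finsetSum _ fun q _ =>
        integrable_finsetSum _ fun r _ => ie q r, mul_left_comm, Finset.mul_sum]
      congr 1
      refine Finset.sum_congr rfl fun q _ => ?_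
      rw [integral_finsetSum _ fun r _ => ie q r, Finset.mul_sum]
      refine Finset.sum_congr rfl fun r _ => ?_
      rw [integral_add (isw _ _ (hZm r) (hYm q)) (isw _ _ (hYm q) (hZm r)), mul_add]
    · obtain ⟨a1, a2, -⟩ := h₁ fun q => Y q t
      obtain ⟨b1, -, b3⟩ := h₂ fun q => Z q t
      have e : charIncr θ₁ (fun q => Y q t) * charIncr θ₂ (fun q => Z q t)
          - linIncr θ₁ (fun q => Y q t) * linIncr θ₂ (fun q => Z q t)
          = (charIncr θ₁ (fun q => Y q t) - linIncr θ₁ (fun q => Y q t))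
              * charIncr θ₂ (fun q => Z q t)
            + linIncr θ₁ (fun q => Y q t)
              * (charIncr θ₂ (fun q => Z q t) - linIncr θ₂ (fun q => Z q t)) := by ring
      rw [e]
      refine (norm_add_le _ _).trans ?_
      rw [norm_mul, norm_mul]
      have hw1 : 0 ≤ ∑ q, weight (Y q t) := Finset.sum_nonneg fun q _ => weight_nonneg _
      have hs1 : 0 ≤ ∑ q, √(weight (Y q t)) := Finset.sum_nonneg fun q _ => Real.sqrt_nonneg _
      have m1 := mul_le_mul a1 b3 (norm_nonneg _) (by positivity)
      have m2 := mul_le_mul a2 b1 (norm_nonneg _) (by positivity)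
      refine (add_le_add m1 m2).trans_eq ?_
      have e1 : ∑ q, ∑ r, (√(weight (Z r t)) * weight (Y q t)
          + √(weight (Y q t)) * weight (Z r t))
          = (∑ q, weight (Y q t)) * (∑ r, √(weight (Z r t)))
            + (∑ q, √(weight (Y q t))) * ∑ r, weight (Z r t) := by
        simp only [Finset.sum_mul_sum, ← Finset.sum_add_distrib]
        refine Finset.sum_congr rfl fun q _ => Finset.sum_congr rfl fun r _ => ?_
        ring
      rw [e1]
      ring
  simpa using hdiff.add hlin

end Blocks

/-! ### Convolution roots of the finite-dimensional distributions -/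

section Main

variable {Ω : Type*} [MeasurableSpace Ω] {P : Measure Ω} {l d : ℕ}
  {X : (Fin l → ℝ) → Ω → EuclideanSpace ℝ (Fin d)}

lemma integral_expI_pow_eq_of_root (hmeas : ∀ t, Measurable (X t)) {N n : ℕ}
    {s : Fin N → (Fin l → ℝ)} {ν : Measure (Fin N → EuclideanSpace ℝ (Fin d))}
    [IsProbabilityMeasure ν]
    (hν : jointLaw P X s = (Measure.pi (fun _ : Fin n => ν)).map (fun x => ∑ i, x i))
    {f : (Fin N → EuclideanSpace ℝ (Fin d)) → ℝ} (hf : Measurable f)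
    (hadd : ∀ x y, f (x + y) = f x + f y) :
    (∫ x, expI (f x) ∂ν) ^ n = ∫ ω, expI (f fun i => X (s i) ω) ∂P := by
  have hmf : Measurable fun x => expI (f x) := by fun_prop
  have h1 : ∫ x, expI (f x) ∂jointLaw P X s = ∫ ω, expI (f fun i => X (s i) ω) ∂P := by
    rw [jointLaw, integral_map (by fun_prop) hmf.aestronglyMeasurable]
  have hsum : ∀ x : Fin n → Fin N → EuclideanSpace ℝ (Fin d), f (∑ i, x i) = ∑ i, f (x i) :=
    fun x => map_sum (AddMonoidHom.mk' f hadd) x Finset.univ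
  rw [← h1, hν, integral_map (Measurable.aemeasurable (by fun_prop)) hmf.aestronglyMeasurable]
  simp only [hsum, expI_sum]
  rw [integral_fintype_prod_eq_prod (fun (_ : Fin n) x => expI (f x))]
  simp

/-- The nontrivial implication: the codifference condition on the diagonal entails mixing. -/
lemma isMixing_of_tendsto_integral_expI_sub [IsProbabilityMeasure P]
    (hmeas : ∀ t, Measurable (X t)) (hstat : IsStrictlyStationary P X)
    (hid : IsInfinitelyDivisibleField P X)
    {Q₀ : Measure (EuclideanSpace ℝ (Fin d))} (hQ₀ : IsLevyMeasureOf Q₀ (P.map (X 0)))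
    (hnull : Q₀ {x | ∃ j : Fin d, ∃ a : ℤ, x j = 2 * Real.pi * (a : ℝ)} = 0)
    (hcond : ∀ j, ∀ t ∈ EscapingSeq l,
      Tendsto (fun n => ∫ ω, expI (X (t n) ω j - X 0 ω j) ∂P) atTop
        (𝓝 ((∫ ω, expI (X 0 ω j) ∂P) * ∫ ω, expI (-X 0 ω j) ∂P))) :
    IsMixing P X := by
  obtain ⟨α, S, hS, hQ, hchar⟩ := hQ₀
  intro m s p θ₁ θ₂ t ht
  set ψ := levyExponent α S Q₀ with hψ
  have hψc : Continuous ψ := hQ.continuous_levyExponent α S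
  have hψ0 : ψ 0 = 0 := levyExponent_zero α S Q₀
  have hX0 : ∀ u, ∫ ω, expI (inner ℝ u (X 0 ω)) ∂P = Complex.exp (ψ u) := by
    intro u
    rw [← integral_map (f := fun x => expI (inner ℝ u x)) (hmeas 0).aemeasurable
      (Continuous.aestronglyMeasurable (by fun_prop))]
    exact hchar u
  have hXs : ∀ r u, ∫ ω, expI (inner ℝ u (X r ω)) ∂P = Complex.exp (ψ u) := fun r u => by
    rw [hstat.integral_comp_eq_zero hmeas r (F := fun x => expI (inner ℝ u x)) (by fun_prop), hX0]
  -- `ν k` is a `(k + 1)`-st convolution root of the law of `(X_{s q}, X_{p r + t k})`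
  choose ν hνp hν using fun k : ℕ =>
    hid (m + m) (Fin.append s fun i => p i + t k) (k + 1) (Nat.le_add_left 1 k)
  set Y : Fin m → (Fin (m + m) → EuclideanSpace ℝ (Fin d)) → EuclideanSpace ℝ (Fin d) :=
    fun q x => x (Fin.castAdd m q) with hYdef
  set Z : Fin m → (Fin (m + m) → EuclideanSpace ℝ (Fin d)) → EuclideanSpace ℝ (Fin d) :=
    fun q x => x (Fin.natAdd m q) with hZdef
  have hYm : ∀ q, Measurable (Y q) := fun q => measurable_pi_apply _
  have hZm : ∀ q, Measurable (Z q) := fun q => measurable_pi_apply _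
  have hroot : ∀ (k : ℕ) (f : (Fin (m + m) → EuclideanSpace ℝ (Fin d)) → ℝ), Measurable f →
      (∀ x y, f (x + y) = f x + f y) → (∫ x, expI (f x) ∂ν k) ^ (k + 1)
        = ∫ ω, expI (f fun i => X (Fin.append s (fun i => p i + t k) i) ω) ∂P :=
    fun k f hf hadd => integral_expI_pow_eq_of_root hmeas (hν k) hf hadd
  have hblock : ∀ (i : Fin (m + m)) (k : ℕ) u, ∫ x, expI (inner ℝ u (x i)) ∂ν k
      = Complex.exp (ψ u / ((k : ℂ) + 1)) := by
    intro i k u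
    refine integral_expI_eq_exp_div (measurable_pi_apply i) hψc hψ0 (fun u => ?_) u
    rw [hroot k (fun x => inner ℝ u (x i)) (by fun_prop)
      (fun x y => by rw [Pi.add_apply, inner_add_right]), hXs]
  have hY : ∀ q (k : ℕ) u, ∫ x, expI (inner ℝ u (Y q x)) ∂ν k
      = Complex.exp (ψ u / ((k : ℂ) + 1)) := fun q => hblock _
  have hZ : ∀ q (k : ℕ) u, ∫ x, expI (inner ℝ u (Z q x)) ∂ν k
      = Complex.exp (ψ u / ((k : ℂ) + 1)) := fun q => hblock _
  have hsm : ∀ (c : ℝ) (a : Fin d) (x : EuclideanSpace ℝ (Fin d)),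
      inner ℝ (c • EuclideanSpace.single a (1 : ℝ)) x = c * x a := fun c a x => by
    rw [real_inner_smul_left, EuclideanSpace.inner_single_left]; simp
  have hmX : ∀ r a, Measurable fun ω => X r ω a := fun r a => by
    have := hmeas r
    fun_prop
  -- both signs of the second exponent are treated at once
  have hcoord : ∀ σ : ℝ, σ = 1 ∨ σ = -1 → ∀ q r a b, Tendsto (fun k : ℕ => ((k : ℂ) + 1) *
      ∫ x, (expI (Y q x a) - 1) * (expI (σ * Z r x b) - 1) ∂ν k) atTop (𝓝 0) := by
    intro σ hσ q r a b
    refine tendsto_succ_mul_integral_expI_sub_one_mul (P := P) (x := fun ω => X (s q) ω a)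
      (v := fun k ω => σ * X (p r + t k) ω b)
      (a := fun τ => ψ (τ • EuclideanSpace.single a (1 : ℝ)))
      (b := ψ (σ • EuclideanSpace.single b (1 : ℝ))) (hmX _ _)
      (fun k => (hmX _ _).const_mul σ) (by have := hYm q; fun_prop) (by have := hZm r; fun_prop)
      (by fun_prop) (by simpa using hψ0) (fun k τ => ?_) (fun k => ?_) (fun k => ?_)
      (fun τ => ?_)
    · rw [hroot k (fun x => τ * Y q x a + σ * Z r x b)
        (by have := hYm q; have := hZm r; fun_prop)
        (fun x y => by simp only [hYdef, hZdef, Pi.add_apply, PiLp.add_apply]; ring)]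
      simp only [hYdef, hZdef, Fin.append_left, Fin.append_right]
    · have := hY q k ((1 : ℝ) • EuclideanSpace.single a (1 : ℝ))
      simpa only [hsm, one_mul] using this
    · have := hZ r k (σ • EuclideanSpace.single b (1 : ℝ))
      simpa only [hsm] using this
    · have hg : Measurable fun ω => expI (τ * X (s q) ω a) :=
        measurable_expI.comp ((hmX _ _).const_mul τ)
      have hE1 : ∫ ω, expI (τ * X (s q) ω a) ∂P
          = Complex.exp (ψ (τ • EuclideanSpace.single a (1 : ℝ))) := by
        rw [← hXs (s q)]
        simp only [hsm]
      have hE2 : ∫ ω, expI (σ * X 0 ω b) ∂P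
          = Complex.exp (ψ (σ • EuclideanSpace.single b (1 : ℝ))) := by
        rw [← hX0]
        simp only [hsm]
      rw [← hE1, ← hE2]
      simp only [expI_add]
      rcases hσ with rfl | rfl
      · simp only [one_mul]
        exact hstat.tendsto_integral_mul_expI hmeas (hcond b) (add_mem_escapingSeq ht (p r)) hg
          fun ω => by simp
      · simp only [neg_one_mul]
        exact hstat.tendsto_integral_mul_expI_neg hmeas (hcond b) (add_mem_escapingSeq ht (p r)) hg
          fun ω => by simp
  have hpos : ∀ q r a b, Tendsto (fun k : ℕ => ((k : ℂ) + 1) *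
      ∫ x, (expI (Y q x a) - 1) * (expI (Z r x b) - 1) ∂ν k) atTop (𝓝 0) := fun q r a b => by
    simpa only [one_mul] using hcoord 1 (Or.inl rfl) q r a b
  have hneg : ∀ q r a b, Tendsto (fun k : ℕ => ((k : ℂ) + 1) *
      ∫ x, (expI (Y q x a) - 1) * (expI (-Z r x b) - 1) ∂ν k) atTop (𝓝 0) := fun q r a b => by
    simpa only [neg_one_mul] using hcoord (-1) (Or.inr rfl) q r a b
  have hbdY := fun q => exists_bound_integral_weight_comp hS hQ (hYm q) (hY q)
  have hbdZ := fun q => exists_bound_integral_weight_comp hS hQ (hZm q) (hZ q)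
  have hww : ∀ q r, Tendsto (fun k : ℕ => ((k : ℝ) + 1) *
      ∫ x, weight (Y q x) * weight (Z r x) ∂ν k) atTop (𝓝 0) := fun q r =>
    tendsto_succ_mul_integral_weight_mul_weight hS hQ hnull (hYm q) (hZm r) (hY q) (hZ r)
      (tendsto_succ_mul_integral_latticeGap_mul (hYm q) (hZm r) (hpos q r) (hneg q r))
  have hAB := tendsto_succ_mul_integral_charIncr_mul hYm hZm hpos
    (fun q r => tendsto_succ_mul_integral_sqrt_weight_mul_weight (hYm q) (hZm r) (hbdZ r)
      (hww q r))
    (fun q r => tendsto_succ_mul_integral_sqrt_weight_mul_weight (hZm r) (hYm q) (hbdY q)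
      (by simpa only [mul_comm (weight (Z r _))] using hww q r)) θ₁ θ₂
  obtain ⟨CA, hCA⟩ := exists_bound_integral_charIncr hYm hbdY hY θ₁
  obtain ⟨CB, hCB⟩ := exists_bound_integral_charIncr hZm hbdZ hZ θ₂
  -- the law of the field, expressed through the roots
  have hsumY : ∀ x, charIncr θ₁ (fun q => Y q x) + 1 = expI (∑ q, inner ℝ (θ₁ q) (Y q x)) :=
    fun x => by rw [charIncr, sub_add_cancel]
  have hsumZ : ∀ x, charIncr θ₂ (fun q => Z q x) + 1 = expI (∑ q, inner ℝ (θ₂ q) (Z q x)) :=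
    fun x => by rw [charIncr, sub_add_cancel]
  have eA : ∀ k, ∫ ω, expI (∑ i, inner ℝ (θ₁ i) (X (s i) ω)) ∂P
      = (∫ x, (charIncr θ₁ (fun q => Y q x) + 1) ∂ν k) ^ (k + 1) := by
    intro k
    simp only [hsumY]
    rw [hroot k (fun x => ∑ q, inner ℝ (θ₁ q) (Y q x)) (by fun_prop)
      (fun x y => by simp only [hYdef, Pi.add_apply, inner_add_right, Finset.sum_add_distrib])]
    simp only [hYdef, Fin.append_left]
  have eB : ∀ k, ∫ ω, expI (∑ i, inner ℝ (θ₂ i) (X (p i) ω)) ∂P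
      = (∫ x, (charIncr θ₂ (fun q => Z q x) + 1) ∂ν k) ^ (k + 1) := by
    intro k
    simp only [hsumZ]
    rw [hroot k (fun x => ∑ q, inner ℝ (θ₂ q) (Z q x)) (by fun_prop)
      (fun x y => by simp only [hZdef, Pi.add_apply, inner_add_right, Finset.sum_add_distrib])]
    simp only [hZdef, Fin.append_right]
    exact (hstat.integral_comp_eq hmeas p (t k)
      (F := fun x => expI (∑ i, inner ℝ (θ₂ i) (x i))) (by fun_prop)).symm
  have eAB : ∀ k, ∫ ω, expI ((∑ i, inner ℝ (θ₁ i) (X (s i) ω))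
        + ∑ i, inner ℝ (θ₂ i) (X (p i + t k) ω)) ∂P
      = (∫ x, (charIncr θ₁ (fun q => Y q x) + 1) * (charIncr θ₂ (fun q => Z q x) + 1) ∂ν k)
        ^ (k + 1) := by
    intro k
    simp only [hsumY, hsumZ, ← expI_add]
    rw [hroot k (fun x => (∑ q, inner ℝ (θ₁ q) (Y q x)) + ∑ q, inner ℝ (θ₂ q) (Z q x))
      (by fun_prop) (fun x y => by
        simp only [hYdef, hZdef, Pi.add_apply, inner_add_right, Finset.sum_add_distrib]; ring)]
    simp only [hYdef, hZdef, Fin.append_left, Fin.append_right]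
  have hgoal : Tendsto (fun k => ∫ ω, expI ((∑ i, inner ℝ (θ₁ i) (X (s i) ω))
        + ∑ i, inner ℝ (θ₂ i) (X (p i + t k) ω)) ∂P) atTop
      (𝓝 ((∫ ω, expI (∑ i, inner ℝ (θ₁ i) (X (s i) ω)) ∂P)
        * ∫ ω, expI (∑ i, inner ℝ (θ₂ i) (X (p i) ω)) ∂P)) := by
    rw [tendsto_iff_norm_sub_tendsto_zero]
    have hbound : Tendsto (fun k : ℕ => ‖((k : ℂ) + 1) *
        ∫ x, charIncr θ₁ (fun q => Y q x) * charIncr θ₂ (fun q => Z q x) ∂ν k‖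
        + CA * CB * (1 / ((k : ℝ) + 1))) atTop (𝓝 0) := by
      simpa using hAB.norm.add
        ((tendsto_one_div_add_atTop_nhds_zero_nat (𝕜 := ℝ)).const_mul (CA * CB))
    refine squeeze_zero (fun k => norm_nonneg _) (fun k => ?_) hbound
    have iA := integrable_charIncr (ν := ν) hYm θ₁ k
    have iB := integrable_charIncr (ν := ν) hZm θ₂ k
    have mA : Measurable fun x => charIncr θ₁ (fun q => Y q x) :=
      (measurable_charIncr θ₁).comp (by fun_prop)
    have mB : Measurable fun x => charIncr θ₂ (fun q => Z q x) :=
      (measurable_charIncr θ₂).comp (by fun_prop)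
    have iAB : Integrable (fun x => charIncr θ₁ (fun q => Y q x) * charIncr θ₂ (fun q => Z q x))
        (ν k) :=
      integrable_of_measurable_of_bound (mA.mul mB) (C := 2 * 2) fun x => by
        rw [norm_mul]
        exact mul_le_mul (norm_charIncr_le _ _) (norm_charIncr_le _ _) (norm_nonneg _) zero_le_two
    have hle : ∀ f : (Fin (m + m) → EuclideanSpace ℝ (Fin d)) → ℂ, (∀ x, ‖f x‖ ≤ 1) →
        ‖∫ x, f x ∂ν k‖ ≤ 1 := fun f hf =>
      (norm_integral_le_of_norm_le_const (C := 1) (Eventually.of_forall hf)).trans (by simp)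
    have n1 : ∀ x, ‖charIncr θ₁ (fun q => Y q x) + 1‖ ≤ 1 := fun x => by rw [hsumY, norm_expI]
    have n2 : ∀ x, ‖charIncr θ₂ (fun q => Z q x) + 1‖ ≤ 1 := fun x => by rw [hsumZ, norm_expI]
    rw [eAB k, eA k, eB k, ← mul_pow]
    refine (norm_pow_sub_pow_le (hle _ fun x => ?_) ?_ _).trans ?_
    · rw [norm_mul]; exact mul_le_one₀ (n1 x) (norm_nonneg _) (n2 x)
    · rw [norm_mul]; exact mul_le_one₀ (hle _ n1) (norm_nonneg _) (hle _ n2)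
    have ecov : (∫ x, (charIncr θ₁ (fun q => Y q x) + 1) * (charIncr θ₂ (fun q => Z q x) + 1) ∂ν k)
        - (∫ x, (charIncr θ₁ (fun q => Y q x) + 1) ∂ν k)
          * (∫ x, (charIncr θ₂ (fun q => Z q x) + 1) ∂ν k)
        = (∫ x, charIncr θ₁ (fun q => Y q x) * charIncr θ₂ (fun q => Z q x) ∂ν k)
          - (∫ x, charIncr θ₁ (fun q => Y q x) ∂ν k) * ∫ x, charIncr θ₂ (fun q => Z q x) ∂ν k := by
      have e : ∀ x, (charIncr θ₁ (fun q => Y q x) + 1) * (charIncr θ₂ (fun q => Z q x) + 1)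
          = charIncr θ₁ (fun q => Y q x) * charIncr θ₂ (fun q => Z q x)
            + charIncr θ₁ (fun q => Y q x) + charIncr θ₂ (fun q => Z q x) + 1 := fun x => by ring
      have i2 : Integrable (fun x => charIncr θ₁ (fun q => Y q x) * charIncr θ₂ (fun q => Z q x)
            + charIncr θ₁ (fun q => Y q x)) (ν k) := iAB.add iA
      have i3 : Integrable (fun x => charIncr θ₁ (fun q => Y q x) * charIncr θ₂ (fun q => Z q x)
            + charIncr θ₁ (fun q => Y q x) + charIncr θ₂ (fun q => Z q x)) (ν k) := i2.add iB
      simp only [e]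
      rw [integral_add i3 (integrable_const _), integral_add i2 iB, integral_add iAB iA,
        integral_add iA (integrable_const _), integral_add iB (integrable_const _)]
      simp
      ring
    rw [ecov]
    have hk : (0 : ℝ) < (k : ℝ) + 1 := by positivity
    have hnA := hCA k
    have hnB := hCB k
    have hCA0 : 0 ≤ CA := le_trans (by positivity) hnA
    have hprod : ((k : ℝ) + 1) * (‖∫ x, charIncr θ₁ (fun q => Y q x) ∂ν k‖
        * ‖∫ x, charIncr θ₂ (fun q => Z q x) ∂ν k‖) ≤ CA * CB * (1 / ((k : ℝ) + 1)) := by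
      have := mul_le_mul hnA hnB (by positivity) hCA0
      rw [mul_one_div, le_div_iff₀ hk]
      refine le_trans (le_of_eq ?_) this
      ring
    rw [norm_mul, norm_natCast_add_one]
    have h3 := norm_sub_le (∫ x, charIncr θ₁ (fun q => Y q x) * charIncr θ₂ (fun q => Z q x) ∂ν k)
      ((∫ x, charIncr θ₁ (fun q => Y q x) ∂ν k) * ∫ x, charIncr θ₂ (fun q => Z q x) ∂ν k)
    rw [norm_mul] at h3
    have h4 := mul_le_mul_of_nonneg_left h3 hk.le
    push_cast
    linarith
  simpa only [expI, Complex.ofReal_add, mul_add] using hgoal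

end Main

end RandomField

end

theorem mainTheorem1 {Ω : Type*} [MeasurableSpace Ω] (P : Measure Ω) [IsProbabilityMeasure P]
    (l d : ℕ) (X : (Fin l → ℝ) → Ω → EuclideanSpace ℝ (Fin d))
    (hmeas : ∀ t, Measurable (X t))
    (hstat : RandomField.IsStrictlyStationary P X)
    (hid : RandomField.IsInfinitelyDivisibleField P X)
    (Q₀ : Measure (EuclideanSpace ℝ (Fin d)))
    (hQ₀ : RandomField.IsLevyMeasureOf Q₀ (P.map (X 0)))
    (hQ₀_null : Q₀ {x | ∃ j : Fin d, ∃ a : ℤ, x j = 2 * Real.pi * (a : ℝ)} = 0) :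
    RandomField.IsMixing P X ↔
      ∀ j k : Fin d, ∀ t ∈ RandomField.EscapingSeq l,
        Tendsto
          (fun n : ℕ =>
            ∫ ω, Complex.exp (Complex.I * ((X (t n) ω j - X 0 ω k : ℝ) : ℂ)) ∂P)
          atTop
          (𝓝 ((∫ ω, Complex.exp (Complex.I * ((X 0 ω j : ℝ) : ℂ)) ∂P)
            * ∫ ω, Complex.exp (-(Complex.I * ((X 0 ω k : ℝ) : ℂ))) ∂P)) := by
  constructor
  · intro h j k t ht
    have h1 := h 1 0 0 (fun _ => -EuclideanSpace.single k (1 : ℝ))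
      (fun _ => EuclideanSpace.single j (1 : ℝ)) t ht
    simp only [Finset.univ_unique, Finset.sum_singleton, Pi.zero_apply, zero_add, inner_neg_left,
      EuclideanSpace.inner_single_left, map_one, one_mul, Complex.ofReal_neg, mul_neg] at h1
    rw [mul_comm]
    refine h1.congr fun n => ?_
    refine integral_congr_ae (Eventually.of_forall fun ω => ?_)
    simp only
    congr 1
    push_cast
    ring
  · intro h
    refine RandomField.isMixing_of_tendsto_integral_expI_sub hmeas hstat hid hQ₀ hQ₀_null
      fun j t ht => ?_
    simpa only [RandomField.expI, Complex.ofReal_neg, mul_neg] using h j j t ht
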